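/- Let $V$ be a vector space over $\mathbb F_2$ (possibly infinite-dimensional) and let $G\le \mathrm{GL}(V)$ be generated by a set $D$ that is closed under conjugation by $G$ and consists of elements $d$ of order $3$ whose commutator space $[V,d]=\{vd-v\mid v\in V\}$ is $2$-dimensional. For $d\in\mathrm{GL}(V)$ put $C_V(d)=\{v\in V\mid vd=v\}$. Assume $[V,G]=V$ and $C_V(G)=\{0\}$. Let $\mathcal L=\{[V,d]\mid d\in D\}$ be the set of *lines*, and assume that distinct lines intersect in $\{0\}$ (there are no $D$-points). A *spread* of a $4$-dimensional subspace $W\le V$ is a set of five $2$-dimensional subspaces of $W$ pairwise intersecting in $\{0\}$. A spread is *full* if it consists of five lines. If $d,e\in D$, $[V,d]\ne[V,e]$, $[V,e]\not\le C_V(d)$ and $W=[V,d]+[V,e]$ contains exactly four lines, then the spread of $W$ containing these four lines is called *tangent*, and its fifth member is called a *singular line*. Let $\mathcal F$, $\mathcal T$ and $\mathcal L_S$ be the sets of full spreads, tangent spreads and singular lines. A *hyperbolic* spread is the set of all members of $\mathcal L\cup\mathcal L_S$ contained in $[V,d]+s$, where $s\in\mathcal L_S$ and $d\in D$ with $s\not\le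 C_V(d)$. A *singular* spread is a spread (of some $4$-dimensional $\mathbb F_2$-subspace) consisting of five singular lines. Let $\mathcal H$ and $\mathcal S$ be the sets of hyperbolic and singular spreads. Let $\Delta$ be the geometry with point set $\mathcal L$ in which two distinct lines are collinear if some spread in $\mathcal F\cup\mathcal T$ contains both. **Theorem.** Suppose $\Delta$ is connected (and non-empty) and $\mathcal F=\emptyset$. Then $(\mathcal L\cup\mathcal L_S,\ \mathcal T\cup\mathcal H\cup\mathcal S)$ is a projective space of order $4$ (a linear space satisfying the Veblen–Young axiom, with five points on each block; a single point without blocks is allowed). Moreover there are an $\mathbb F_4$-vector space structure $V_4$ on the additive group of $V$ and a nondegenerate Hermitian form $h$ on $V_4$ such that: 1. the elements of $\mathcal L\cup\mathcal L_S$ are exactly the $1$-dimensional subspaces of $V_4$, and the blocks are exactly the sets of $1$-dimensional subspaces contained in a $2$-dimensional subspace of $V_4$; 2. $p\mapsto\{q\mid h(p,q)=0\}$ is a (Hermitian) polarity of this projective space, that is, an injective map $\pi$ from points to hyperplanes with $q\in\pi(p)\Leftrightarrow p\in\pi(q)$, and its set of absolute points is exactly $\mathcal L_S$; 3. every element of $G$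 is $\mathbb F_4$-linear and preserves $h$, and $G$ equals $\mathrm{FU}(V_4,h)$, the group of all $\mathbb F_4$-linear isometries $g$ of $h$ with $[V,g]$ finite-dimensional (so $G\cong \mathrm{FU}(V_4,h)$ via the identity on $V$); 4. for $a\in\mathbb F_4\setminus\{0,1\}$ let $R_a$ be the set of maps $w\mapsto w+a\,h(w,v)\,v$ with $h(v,v)=1$. Each of the two sets $R_a$ is a conjugacy class of $G$, their union is the set of all reflections in $G$ (a reflection being a map $w\mapsto w-\varphi(w)v$ with $\varphi\in V_4^*$ and $\varphi(v)\ne0,1$), and $D$ is either one of the two classes $R_a$ or their union. -/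

import Mathlib

namespace OrderThree

section Commutators

variable {V : Type*} [AddCommGroup V] [Module (ZMod 2) V]

/-- The commutator space `[V, d] = {v d - v ∣ v ∈ V}`. -/
def comm (d : V ≃ₗ[ZMod 2] V) : Submodule (ZMod 2) V :=
  LinearMap.range ((d : V →ₗ[ZMod 2] V) - LinearMap.id)

/-- The centralizer `C_V(d) = {v ∣ v d = v}`. -/
def cent (d : V ≃ₗ[ZMod 2] V) : Submodule (ZMod 2) V :=
  LinearMap.ker ((d : V →ₗ[ZMod 2] V) - LinearMap.id)

/-- The set `𝓛` of `D`-lines `[V, d]`, `d ∈ D`. -/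
def dLines (D : Set (V ≃ₗ[ZMod 2] V)) : Set (Submodule (ZMod 2) V) :=
  {l | ∃ d ∈ D, l = comm d}

/-- The set `𝓟` of `D`-points: the `1`-spaces that are the intersection of two distinct
`D`-lines. -/
def dPoints (D : Set (V ≃ₗ[ZMod 2] V)) : Set (Submodule (ZMod 2) V) :=
  {p | Module.finrank (ZMod 2) p = 1 ∧ ∃ l ∈ dLines D, ∃ m ∈ dLines D, l ≠ m ∧ p = l ⊓ m}

/-- `S` is a spread of the `4`-dimensional subspace `W`: five `2`-dimensional subspaces of `W`
that pairwise intersect in `0`. -/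
def IsSpread (W : Submodule (ZMod 2) V) (S : Set (Submodule (ZMod 2) V)) : Prop :=
  Module.finrank (ZMod 2) W = 4 ∧ S.ncard = 5 ∧
    (∀ l ∈ S, l ≤ W ∧ Module.finrank (ZMod 2) l = 2) ∧
    ∀ l ∈ S, ∀ m ∈ S, l ≠ m → l ⊓ m = ⊥

/-- `𝓕`: the full spreads, which consist of five `D`-lines. -/
def fullSpreads (D : Set (V ≃ₗ[ZMod 2] V)) : Set (Set (Submodule (ZMod 2) V)) :=
  {S | (∃ W, IsSpread W S) ∧ S ⊆ dLines D}

/-- `𝓣`: the tangent spreads. If `[V, d] ≠ [V, e]`, `d` does not centralize `[V, e]`, and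
`W = [V, d] + [V, e]` contains exactly four `D`-lines, then the spread of `W` that contains these
four `D`-lines is a tangent spread. -/
def tangentSpreads (D : Set (V ≃ₗ[ZMod 2] V)) : Set (Set (Submodule (ZMod 2) V)) :=
  {S | ∃ d ∈ D, ∃ e ∈ D, comm d ≠ comm e ∧ ¬ comm e ≤ cent d ∧
    {l ∈ dLines D | l ≤ comm d ⊔ comm e}.ncard = 4 ∧
    IsSpread (comm d ⊔ comm e) S ∧ {l ∈ dLines D | l ≤ comm d ⊔ comm e} ⊆ S}

/-- `𝓛_S`: the singular lines, i.e. the fifth members of the tangent spreads. -/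
def singularLines (D : Set (V ≃ₗ[ZMod 2] V)) : Set (Submodule (ZMod 2) V) :=
  {s | ∃ S ∈ tangentSpreads D, s ∈ S ∧ s ∉ dLines D}

/-- `𝓗`: the hyperbolic spreads, which consist of the `D`-lines and singular lines inside
`[V, d] + s`, where the singular line `s` is not centralized by `d ∈ D`. -/
def hyperbolicSpreads (D : Set (V ≃ₗ[ZMod 2] V)) : Set (Set (Submodule (ZMod 2) V)) :=
  {S | ∃ d ∈ D, ∃ s ∈ singularLines D, ¬ s ≤ cent d ∧
    S = {l ∈ dLines D ∪ singularLines D | l ≤ comm d ⊔ s}}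

/-- `𝓢`: the singular spreads, which consist of five singular lines inside a `4`-dimensional
subspace over the field with two elements. -/
def singularSpreads (D : Set (V ≃ₗ[ZMod 2] V)) : Set (Set (Submodule (ZMod 2) V)) :=
  {S | (∃ W, IsSpread W S) ∧ S ⊆ singularLines D}

/-- The collinearity graph of the partial linear space `Δ = (𝓛, 𝓕 ∪ 𝓣)`. -/
def deltaGraph (D : Set (V ≃ₗ[ZMod 2] V)) : SimpleGraph (dLines D) where
  Adj l m := l ≠ m ∧ ∃ S ∈ fullSpreads D ∪ tangentSpreads D, l.1 ∈ S ∧ m.1 ∈ S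
  symm := ⟨fun _ _ ⟨h, S, hS, hl, hm⟩ => ⟨h.symm, S, hS, hm, hl⟩⟩
  loopless := ⟨fun _ h => h.1 rfl⟩

/-- The points `𝓛 ∪ 𝓛_S`. -/
def geomPoints (D : Set (V ≃ₗ[ZMod 2] V)) : Set (Submodule (ZMod 2) V) :=
  dLines D ∪ singularLines D

/-- The blocks `𝓣 ∪ 𝓗 ∪ 𝓢`. -/
def geomBlocks (D : Set (V ≃ₗ[ZMod 2] V)) : Set (Set (Submodule (ZMod 2) V)) :=
  tangentSpreads D ∪ hyperbolicSpreads D ∪ singularSpreads D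

end Commutators

section Projective

variable {α : Type*}

/-- The point set `P` with the set `B` of blocks is a projective space of order `q`: a linear
space with `q + 1` points on each block that satisfies the axiom of Veblen and Young. -/
structure IsProjectiveSpace (P : Set α) (B : Set (Set α)) (q : ℕ) : Prop where
  block_subset : ∀ b ∈ B, b ⊆ P
  block_card : ∀ b ∈ B, b.ncard = q + 1
  join : ∀ x ∈ P, ∀ y ∈ P, x ≠ y → ∃! b, b ∈ B ∧ x ∈ b ∧ y ∈ b
  veblen_young : ∀ b₁ ∈ B, ∀ b₂ ∈ B, ∀ c₁ ∈ B, ∀ c₂ ∈ B, ∀ x, b₁ ≠ b₂ → x ∈ b₁ → x ∈ b₂ →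
    (∃ y ∈ c₁ ∩ b₁, y ≠ x) → (∃ y ∈ c₁ ∩ b₂, y ≠ x) →
    (∃ y ∈ c₂ ∩ b₁, y ≠ x) → (∃ y ∈ c₂ ∩ b₂, y ≠ x) → (c₁ ∩ c₂).Nonempty

/-- A hyperplane: a proper subspace that meets every block. -/
structure IsHyperplane (P : Set α) (B : Set (Set α)) (H : Set α) : Prop where
  subset : H ⊆ P
  ne : H ≠ P
  closed : ∀ b ∈ B, ∀ x ∈ b ∩ H, ∀ y ∈ b ∩ H, x ≠ y → b ⊆ H
  meets : ∀ b ∈ B, (b ∩ H).Nonempty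

/-- A (nondegenerate) polarity: an injective map `π` from points to hyperplanes such that
`y ∈ π x ↔ x ∈ π y`. -/
structure IsPolarity (P : Set α) (B : Set (Set α)) (π : α → Set α) : Prop where
  hyperplane : ∀ x ∈ P, IsHyperplane P B (π x)
  injOn : Set.InjOn π P
  symm : ∀ x ∈ P, ∀ y ∈ P, y ∈ π x → x ∈ π y

/-- The absolute points of a polarity. -/
def absolutePoints (P : Set α) (π : α → Set α) : Set α := {x ∈ P | x ∈ π x}

end Projective

/-- The field with four elements. -/
abbrev F4 : Type := GaloisField 2 2

section Hermitian

variable {V : Type*} [AddCommGroup V] [Module F4 V]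

/-- The form `h` (linear in the first argument, semilinear with respect to `a ↦ a ^ 2` in the
second) is a nondegenerate Hermitian form. -/
structure IsNondegHermitian (h : V →ₗ[F4] V →ₛₗ[frobenius F4 2] F4) : Prop where
  hermitian : ∀ x y, h y x = h x y ^ 2
  nondegenerate : ∀ x, (∀ y, h x y = 0) → x = 0

/-- The finitary unitary group `FU(V₄, h)`: the `F4`-linear isometries `g` of `h` with `[V, g]`
finite-dimensional. -/
def finitaryUnitary (h : V →ₗ[F4] V →ₛₗ[frobenius F4 2] F4) : Subgroup (V ≃ₗ[F4] V) where
  carrier := {g | (∀ x y, h (g x) (g y) = h x y) ∧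
    FiniteDimensional F4 (LinearMap.range ((g : V →ₗ[F4] V) - LinearMap.id))}
  mul_mem' := by
    rintro a b ⟨ha, ha'⟩ ⟨hb, hb'⟩
    refine ⟨fun x y => by rw [LinearEquiv.mul_apply, LinearEquiv.mul_apply, ha, hb], ?_⟩
    refine Submodule.finiteDimensional_of_le
      (S₂ := LinearMap.range ((a : V →ₗ[F4] V) - LinearMap.id) ⊔
        LinearMap.range ((b : V →ₗ[F4] V) - LinearMap.id)) ?_
    rintro _ ⟨x, rfl⟩
    refine Submodule.mem_sup.2 ⟨_, ⟨b x, rfl⟩, _, ⟨x, rfl⟩, ?_⟩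
    simp
  one_mem' := by
    refine ⟨fun _ _ => rfl, ?_⟩
    refine Submodule.finiteDimensional_of_le (S₂ := ⊥) ?_
    rintro _ ⟨x, rfl⟩
    simp
  inv_mem' := by
    rintro a ⟨ha, ha'⟩
    have key : ∀ x, a (a⁻¹ x) = x := fun x => by rw [← LinearEquiv.mul_apply]; simp
    refine ⟨fun x y => by rw [← ha, key, key], ?_⟩
    refine Submodule.finiteDimensional_of_le
      (S₂ := LinearMap.range ((a : V →ₗ[F4] V) - LinearMap.id)) ?_
    rintro _ ⟨x, rfl⟩
    refine ⟨-(a⁻¹ x), ?_⟩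
    have h1 := key x
    simp only [LinearMap.sub_apply, LinearEquiv.coe_coe, LinearMap.id_apply, map_neg, h1]
    abel

variable [Module (ZMod 2) V]

/-- `g` is a reflection `w ↦ w - φ(w) v` of `V₄`, where `φ(v) ≠ 0, 1`. -/
def IsReflection (g : V ≃ₗ[ZMod 2] V) : Prop :=
  ∃ (v : V) (φ : V →ₗ[F4] F4), φ v ≠ 0 ∧ φ v ≠ 1 ∧ ∀ w, g w = w - φ w • v

/-- The unitary reflections `w ↦ w + a h(w, v) v`, where `h(v, v) = 1`, for a fixed scalar `a`. -/
def unitaryReflections (h : V →ₗ[F4] V →ₛₗ[frobenius F4 2] F4) (a : F4) :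
    Set (V ≃ₗ[ZMod 2] V) :=
  {g | ∃ v, h v v = 1 ∧ ∀ w, g w = w + (a * h w v) • v}

/-- The geometry of points `P` and blocks `B` is the projective space of `V₄`: its points are the
`1`-dimensional, and its blocks (the point sets of) the `2`-dimensional `F4`-subspaces. -/
structure IsProjectiveSpaceOf (V : Type*) [AddCommGroup V] [Module (ZMod 2) V] [Module F4 V]
    (P : Set (Submodule (ZMod 2) V)) (B : Set (Set (Submodule (ZMod 2) V))) : Prop where
  points : ∀ p, p ∈ P ↔ ∃ U : Submodule F4 V, Module.finrank F4 U = 1 ∧ (p : Set V) = U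
  blocks : ∀ b, b ∈ B ↔ ∃ U : Submodule F4 V, Module.finrank F4 U = 2 ∧
    b = {p ∈ P | (p : Set V) ⊆ U}

/-- `π` is the Hermitian polarity defined by `h`: a polarity with `π(p) = {q ∣ h(p, q) = 0}`. -/
structure IsHermitianPolarity (h : V →ₗ[F4] V →ₛₗ[frobenius F4 2] F4)
    (P : Set (Submodule (ZMod 2) V)) (B : Set (Set (Submodule (ZMod 2) V)))
    (π : Submodule (ZMod 2) V → Set (Submodule (ZMod 2) V)) : Prop extends IsPolarity P B π where
  perp : ∀ p ∈ P, π p = {q ∈ P | ∀ x ∈ p, ∀ y ∈ q, h x y = 0}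

end Hermitian

end OrderThree

/-! Let E consist of D and the inverses of its elements; lines, spreads and G are the same for E as
for D. Everything rests on one count. If d does not centralize [V,e] and the lines differ, then W =
[V,d] + [V,e] already contains four lines: [V,d] and the three images of [V,e] under ⟨d⟩. As full
spreads are excluded there is no fifth, so W contains no line centralized by d (`no_fixed_line`).
This makes centralizing symmetric (`fixes_symm`) and shows that d and e fix the same vectors of W
(`fixed_symm`).

Scalars. On its own line a root d satisfies d² + d + 1 = 0, so it acts there like ω or ω². If d and
e do not centralize each other's lines, then e - 1 identifies [V,d] with [V,e] and compares the two
choices. The comparison is symmetric and transitive (`compat_symm`, `compat_trans`), so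
connectedness allows a consistent choice between d and its inverse. Since the lines span V and
C_V(G) = 0, the chosen actions glue to an endomorphism Ω with Ω² + Ω + 1 = 0 that commutes with all
roots (`exists_omega`). This is the F4-structure.

Form. Each root is now w ↦ w + a φ(w) v, with v on its line and φ(v) = 1. In these terms
`fixed_symm` says that the functionals of two roots satisfy φ(u) = ψ(v)², which is Hermitian
symmetry; since the lines span V, these functionals assemble to h (`exists_form`).

Recognition. Vectors on lines have norm one. If h(u,v) is neither 0 nor 1, some reflection at v maps
u to u + v. From this, and the fact that any two lines have a common neighbour, every nonzero vector
lies on a line or is a sum l + m of line vectors with h(l,m) = 1 (`vector_cases`). So the lines are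
exactly the points of norm one and the singular lines are the isotropic points, which identifies
points and blocks. That G is all of the finitary unitary group follows by a Cartan–Dieudonné
induction on dim [V,γ] (`mem_closure_of_finitary`). -/

namespace OrderThree

/-! ### Two roots: lines, centralizers and the absence of a fifth line -/

section Local

variable {V : Type*} [AddCommGroup V] [Module (ZMod 2) V]

/-- A set of elements of order three with two-dimensional commutator spaces which is closed under
inversion and under conjugation by its members, without points and full spreads. -/
structure IsRootSet (E : Set (V ≃ₗ[ZMod 2] V)) : Prop where
  conj : ∀ g ∈ E, ∀ d ∈ E, g * d * g⁻¹ ∈ E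
  inv : ∀ d ∈ E, d⁻¹ ∈ E
  cube : ∀ d ∈ E, ∀ x, d (d (d x)) = x
  finrank : ∀ d ∈ E, Module.finrank (ZMod 2) (comm d) = 2
  points : dPoints E = ∅
  full : fullSpreads E = ∅

/-- `d` fixes every vector of the line `[V, e]`. -/
def Fixes (d e : V ≃ₗ[ZMod 2] V) : Prop := ∀ x ∈ comm e, d x = x

lemma two_add (x : V) : x + x = 0 := ZModModule.add_self x

lemma mem_comm {d : V ≃ₗ[ZMod 2] V} {x : V} : x ∈ comm d ↔ ∃ y, d y + y = x := by
  simp only [comm, LinearMap.mem_range, LinearMap.add_apply, LinearEquiv.coe_coe,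
    LinearMap.id_apply, ZModModule.sub_eq_add]

lemma mem_cent {d : V ≃ₗ[ZMod 2] V} {x : V} : x ∈ cent d ↔ d x = x := by
  simp [cent, sub_eq_zero]

lemma add_mem_comm (d : V ≃ₗ[ZMod 2] V) (x : V) : d x + x ∈ comm d := mem_comm.2 ⟨x, rfl⟩

lemma eq_of_add_eq_zero' {x y : V} (h : x + y = 0) : x = y := by
  have := two_add y
  grind

lemma map_mem_comm {d : V ≃ₗ[ZMod 2] V} {x : V} (h : x ∈ comm d) : d x ∈ comm d := by
  obtain ⟨y, rfl⟩ := mem_comm.1 h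
  exact mem_comm.2 ⟨d y, by rw [map_add]⟩

lemma comm_conj (g d : V ≃ₗ[ZMod 2] V) :
    comm (g * d * g⁻¹) = (comm d).map (g : V →ₗ[ZMod 2] V) := by
  ext x
  rw [Submodule.mem_map, mem_comm]
  constructor
  · rintro ⟨y, rfl⟩
    refine ⟨d (g⁻¹ y) + g⁻¹ y, add_mem_comm _ _, ?_⟩
    simp [LinearEquiv.mul_apply]
  · rintro ⟨z, hz, rfl⟩
    obtain ⟨y, rfl⟩ := mem_comm.1 hz
    exact ⟨g y, by simp [LinearEquiv.mul_apply]⟩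

lemma mem_comm_conj {g d : V ≃ₗ[ZMod 2] V} {x : V} : g x ∈ comm (g * d * g⁻¹) ↔ x ∈ comm d := by
  rw [comm_conj]
  constructor
  · rintro ⟨y, hy, h⟩
    rwa [← g.injective h]
  · exact fun h => ⟨x, h, rfl⟩

lemma comm_inv (d : V ≃ₗ[ZMod 2] V) : comm d⁻¹ = comm d := by
  ext x
  rw [mem_comm, mem_comm]
  constructor
  · rintro ⟨y, rfl⟩
    exact ⟨d⁻¹ y, by rw [← LinearEquiv.mul_apply]; simp [add_comm]⟩
  · rintro ⟨y, rfl⟩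
    exact ⟨d y, by rw [← LinearEquiv.mul_apply]; simp [add_comm]⟩

namespace IsRootSet

variable {E : Set (V ≃ₗ[ZMod 2] V)} (hE : IsRootSet E) {d e f : V ≃ₗ[ZMod 2] V}

include hE

/-- From d³ = 1 one gets (d² + d + 1)(d - 1) = 0, so d is a root of X² + X + 1 on [V,d]. -/
lemma rot (hd : d ∈ E) {x : V} (hx : x ∈ comm d) : d (d x) = d x + x := by
  obtain ⟨y, rfl⟩ := mem_comm.1 hx
  have h1 := hE.cube d hd y
  have h2 := two_add (d (d y))
  have h3 := two_add (d y)
  simp only [map_add, h1]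
  grind

lemma inv_apply (hd : d ∈ E) (x : V) : d⁻¹ x = d (d x) := by
  apply d.injective
  rw [hE.cube d hd, ← LinearEquiv.mul_apply]
  simp

lemma eq_zero_of_fixed (hd : d ∈ E) {x : V} (hx : x ∈ comm d) (h : d x = x) : x = 0 := by
  have h1 := hE.rot hd hx
  rw [h, h, two_add] at h1
  exact h1

lemma line_eq (hd : d ∈ E) (he : e ∈ E) {x : V} (hx : x ∈ comm d) (hx' : x ∈ comm e)
    (h0 : x ≠ 0) : comm d = comm e := by
  by_contra hne
  have h1 : Module.finrank (ZMod 2) (comm d ⊓ comm e : Submodule (ZMod 2) V) ≤ 1 := by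
    by_contra hlt
    have := Module.finite_of_finrank_pos (by rw [hE.finrank d hd]; simp : 0 <
      Module.finrank (ZMod 2) (comm d))
    have := Module.finite_of_finrank_pos (by rw [hE.finrank e he]; simp : 0 <
      Module.finrank (ZMod 2) (comm e))
    have h2 : comm d ⊓ comm e = comm d := Submodule.eq_of_le_of_finrank_le inf_le_left (by
      rw [hE.finrank d hd]; omega)
    have h3 : comm d ⊓ comm e = comm e := Submodule.eq_of_le_of_finrank_le inf_le_right (by
      rw [hE.finrank e he]; omega)
    exact hne (h2.symm.trans h3)
  have hfin := Module.finite_of_finrank_pos (by rw [hE.finrank d hd]; simp : 0 <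
      Module.finrank (ZMod 2) (comm d))
  have : Module.Finite (ZMod 2) (comm d ⊓ comm e : Submodule (ZMod 2) V) :=
    Submodule.finiteDimensional_of_le inf_le_left
  have h2 : 0 < Module.finrank (ZMod 2) (comm d ⊓ comm e : Submodule (ZMod 2) V) := by
    rw [Module.finrank_pos_iff]
    exact ⟨⟨⟨x, hx, hx'⟩, 0, fun h => h0 (congrArg Subtype.val h)⟩⟩
  have h3 : (comm d ⊓ comm e) ∈ dPoints E :=
    ⟨by omega, comm d, ⟨d, hd, rfl⟩, comm e, ⟨e, he, rfl⟩, hne, rfl⟩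
  rw [hE.points] at h3
  exact h3

lemma exists_ne_zero (hd : d ∈ E) : ∃ x ∈ comm d, x ≠ 0 := by
  by_contra! h
  have h1 : comm d = ⊥ := (Submodule.eq_bot_iff _).2 h
  have := hE.finrank d hd
  rw [h1, finrank_bot] at this
  omega

lemma mem_cases (hd : d ∈ E) {l x : V} (hl : l ∈ comm d) (h0 : l ≠ 0) (hx : x ∈ comm d) :
    x = 0 ∨ x = l ∨ x = d l ∨ x = d (d l) := by
  classical
  have hfin := Module.finite_of_finrank_pos (by rw [hE.finrank d hd]; simp : 0 <
      Module.finrank (ZMod 2) (comm d))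
  have := Module.finite_of_finite (ZMod 2) (M := comm d)
  have := Fintype.ofFinite (comm d)
  have hc : Fintype.card (comm d) = 4 := by
    rw [Module.card_eq_pow_finrank (K := ZMod 2), hE.finrank d hd]
    simp
  have h1 : d l ≠ l := fun h => h0 (hE.eq_zero_of_fixed hd hl h)
  have h2 : d (d l) ≠ d l := fun h => h1 (d.injective h)
  have h3 : d (d l) ≠ l := fun h => h1 (by
    have := hE.cube d hd l
    rw [h] at this; exact this)
  have h4 : d l ≠ 0 := by simpa using h0
  have h5 : d (d l) ≠ 0 := by simpa using h0
  let s : Finset (comm d) := {0, ⟨l, hl⟩, ⟨d l, map_mem_comm hl⟩,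
    ⟨d (d l), map_mem_comm (map_mem_comm hl)⟩}
  have hs : s.card = 4 := by
    simp only [s]
    rw [Finset.card_insert_of_notMem, Finset.card_insert_of_notMem, Finset.card_insert_of_notMem,
      Finset.card_singleton]
    · simpa using h2.symm
    · simpa using ⟨h1.symm, h3.symm⟩
    · simp only [Finset.mem_insert, Finset.mem_singleton, Subtype.ext_iff, ZeroMemClass.coe_zero,
        not_or]
      exact ⟨h0.symm, h4.symm, h5.symm⟩
  have huniv : s = Finset.univ := (Finset.card_eq_iff_eq_univ s).1 (by rw [hs, hc])
  have hm : (⟨x, hx⟩ : comm d) ∈ s := by rw [huniv]; exact Finset.mem_univ _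
  simpa [s, Subtype.ext_iff] using hm

lemma forall_of_invariant (hd : d ∈ E) {l : V} (hl : l ∈ comm d) (h0 : l ≠ 0) {P : V → Prop}
    (hz : P 0) (h1 : P l) (h2 : P (d l)) (h3 : P (d (d l))) : ∀ x ∈ comm d, P x := by
  intro x hx
  rcases hE.mem_cases hd hl h0 hx with h | h | h | h <;> rwa [h]

/-- The image of [V,e] under d meets [V,e] in m, so it equals [V,e] because there are no points.
Thus d permutes the three nonzero vectors of the line and fixes one of them; having order dividing
three, it fixes all. -/
lemma fixes_of_fixed (hd : d ∈ E) (he : e ∈ E) {m : V} (hm : m ∈ comm e) (h0 : m ≠ 0)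
    (h : d m = m) : Fixes d e := by
  have hc := hE.conj d hd e he
  have h1 : comm (d * e * d⁻¹) = comm e := hE.line_eq hc he
    (h ▸ mem_comm_conj.2 hm) hm h0
  have h2 : ∀ x ∈ comm e, d x ∈ comm e := fun x hx => by
    rw [← h1]; exact mem_comm_conj.2 hx
  have h4 := hE.rot he hm
  have hem : e m ≠ 0 := by simpa using h0
  have h5 : d (e m) = e m := by
    have h6 : d (e m) ≠ m := fun h7 => by
      have h8 : e m = m := d.injective (h7.trans h.symm)
      exact h0 (hE.eq_zero_of_fixed he hm h8)
    rcases hE.mem_cases he hm h0 (h2 _ (map_mem_comm hm)) with h7 | h7 | h7 | h7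
    · exact absurd (by simpa using h7) h0
    · exact absurd h7 h6
    · exact h7
    -- Here d would interchange e m and e² m; then d² fixes e m, and d³ = 1 forces d to fix it as
    -- well.
    · have h8 : d (d (e m)) = e m := by
        rw [h7, h4, map_add, h, h7, h4, add_assoc, two_add, add_zero]
      have h9 := hE.cube d hd (e m)
      rw [h8] at h9; exact h9
  exact hE.forall_of_invariant he hm h0 (map_zero _) h h5 (by rw [h4, map_add, h5, h])

lemma eq_zero_of_not_fixes (hd : d ∈ E) (he : e ∈ E) (h : ¬ Fixes d e) {m : V} (hm : m ∈ comm e)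
    (hfix : d m = m) : m = 0 := by
  by_contra h0
  exact h (hE.fixes_of_fixed hd he hm h0 hfix)

lemma not_fixes_self (hd : d ∈ E) : ¬ Fixes d d := fun h => by
  obtain ⟨x, hx, h0⟩ := hE.exists_ne_zero hd
  exact h0 (hE.eq_zero_of_fixed hd hx (h x hx))

/-- The form in which the absence of full spreads is used: a sum of two lines never contains five
distinct lines. -/
lemma isSpread_of_five {e₁ e₂ e₃ e₄ e₅ : V ≃ₗ[ZMod 2] V} (h₁ : e₁ ∈ E) (h₂ : e₂ ∈ E) (h₃ : e₃ ∈ E)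
    (h₄ : e₄ ∈ E) (h₅ : e₅ ∈ E) (h12 : comm e₁ ≠ comm e₂) (h13 : comm e₁ ≠ comm e₃)
    (h14 : comm e₁ ≠ comm e₄) (h15 : comm e₁ ≠ comm e₅) (h23 : comm e₂ ≠ comm e₃)
    (h24 : comm e₂ ≠ comm e₄) (h25 : comm e₂ ≠ comm e₅) (h34 : comm e₃ ≠ comm e₄)
    (h35 : comm e₃ ≠ comm e₅) (h45 : comm e₄ ≠ comm e₅)
    (hW3 : comm e₃ ≤ comm e₁ ⊔ comm e₂) (hW4 : comm e₄ ≤ comm e₁ ⊔ comm e₂)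
    (hW5 : comm e₅ ≤ comm e₁ ⊔ comm e₂) : False := by
  have hinf : ∀ d ∈ E, ∀ e ∈ E, comm d ≠ comm e → comm d ⊓ comm e = ⊥ := by
    intro d hd e he hne
    rw [Submodule.eq_bot_iff]
    rintro x ⟨hx, hx'⟩
    by_contra h0
    exact hne (hE.line_eq hd he hx hx' h0)
  have hS : ({comm e₁, comm e₂, comm e₃, comm e₄, comm e₅} : Set (Submodule (ZMod 2) V)) ∈
      fullSpreads E := by
    refine ⟨⟨comm e₁ ⊔ comm e₂, ?_, ?_, ?_, ?_⟩, ?_⟩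
    · have := Module.finite_of_finrank_pos (by rw [hE.finrank _ h₁]; simp : 0 <
        Module.finrank (ZMod 2) (comm e₁))
      have := Module.finite_of_finrank_pos (by rw [hE.finrank _ h₂]; simp : 0 <
        Module.finrank (ZMod 2) (comm e₂))
      have h := Submodule.finrank_sup_add_finrank_inf_eq (comm e₁) (comm e₂)
      rw [hinf _ h₁ _ h₂ h12, finrank_bot, hE.finrank _ h₁, hE.finrank _ h₂] at h
      omega
    · rw [Set.ncard_insert_of_notMem, Set.ncard_insert_of_notMem, Set.ncard_insert_of_notMem,
        Set.ncard_pair h45]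
      · simp [h34, h35]
      · simp [h23, h24, h25]
      · simp [h12, h13, h14, h15]
    · rintro l (rfl | rfl | rfl | rfl | rfl)
      · exact ⟨le_sup_left, hE.finrank _ h₁⟩
      · exact ⟨le_sup_right, hE.finrank _ h₂⟩
      · exact ⟨hW3, hE.finrank _ h₃⟩
      · exact ⟨hW4, hE.finrank _ h₄⟩
      · exact ⟨hW5, hE.finrank _ h₅⟩
    · rintro l (rfl | rfl | rfl | rfl | rfl) m (rfl | rfl | rfl | rfl | rfl) hne <;>
        exact hinf _ (by assumption) _ (by assumption) hne
    · rintro l (rfl | rfl | rfl | rfl | rfl)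
      exacts [⟨_, h₁, rfl⟩, ⟨_, h₂, rfl⟩, ⟨_, h₃, rfl⟩, ⟨_, h₄, rfl⟩, ⟨_, h₅, rfl⟩]
  rw [hE.full] at hS
  exact hS

omit hE in
lemma map_mem_sup (d e : V ≃ₗ[ZMod 2] V) {x : V} (hx : x ∈ comm d ⊔ comm e) :
    d x ∈ comm d ⊔ comm e := by
  have h : d x = (d x + x) + x := by rw [add_assoc, two_add, add_zero]
  rw [h]
  exact Submodule.add_mem _ (Submodule.mem_sup_left (add_mem_comm d x)) hx

omit hE in
lemma comm_conj_le_sup (d e k : V ≃ₗ[ZMod 2] V) (h : comm k ≤ comm d ⊔ comm e) :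
    comm (d * k * d⁻¹) ≤ comm d ⊔ comm e := by
  rw [comm_conj]
  rintro _ ⟨x, hx, rfl⟩
  exact map_mem_sup d e (h hx)

lemma line_ne_conj (hd : d ∈ E) (he : e ∈ E) (hne : comm d ≠ comm e) (h : ¬ Fixes d e) :
    comm (d * e * d⁻¹) ≠ comm e := fun heq => by
  obtain ⟨m, hm, h0⟩ := hE.exists_ne_zero he
  have h1 : d m ∈ comm e := heq ▸ mem_comm_conj.2 hm
  have h2 : d m + m ≠ 0 := fun h3 => h0 (hE.eq_zero_of_not_fixes hd he h hm (eq_of_add_eq_zero' h3))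
  exact hne (hE.line_eq hd he (add_mem_comm d m) ((comm e).add_mem h1 hm) h2)

omit hE in
lemma comm_conj_self (d : V ≃ₗ[ZMod 2] V) : comm (d * d * d⁻¹) = comm d := by
  simp

/-- The lines of d, e, ded⁻¹ and d²ed⁻² are distinct and lie in the sum. A line centralized by d is
none of them: d acts without nonzero fixed vectors on its own line and permutes the other three
cyclically. It would be a fifth line. -/
lemma no_fixed_line (hd : d ∈ E) (he : e ∈ E) (hne : comm d ≠ comm e) (h : ¬ Fixes d e)
    {k : V ≃ₗ[ZMod 2] V} (hk : k ∈ E) (hkW : comm k ≤ comm d ⊔ comm e) : ¬ Fixes d k := by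
  intro hfix
  have hM := hE.conj d hd e he
  have hM' := hE.conj d hd _ hM
  have h1 := hE.line_ne_conj hd he hne h
  have hconj : ∀ k : V ≃ₗ[ZMod 2] V, Fixes d (d * k * d⁻¹) → Fixes d k := fun k hk x hx =>
    d.injective (hk (d x) (mem_comm_conj.2 hx))
  have hmap : ∀ a b : V ≃ₗ[ZMod 2] V, comm (d * a * d⁻¹) = comm (d * b * d⁻¹) → comm a = comm b := by
    intro a b hab
    rw [comm_conj, comm_conj] at hab
    exact Submodule.map_injective_of_injective d.injective hab
  have hself : ∀ a : V ≃ₗ[ZMod 2] V, comm d = comm (d * a * d⁻¹) → comm d = comm a := fun a ha =>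
    hmap d a (by rw [comm_conj_self]; exact ha)
  have hfixeq : ∀ a b : V ≃ₗ[ZMod 2] V, comm a = comm b → Fixes d b → Fixes d a := fun a b hab hb x hx =>
    hb x (hab ▸ hx)
  refine hE.isSpread_of_five hd he hM hM' hk hne ?_ ?_ ?_ h1.symm ?_ ?_ ?_ ?_ ?_ ?_ ?_ hkW
  · exact fun h2 => hne (hself _ h2)
  · exact fun h2 => hne (hself _ (hself _ h2))
  · exact fun h2 => hE.not_fixes_self hd (hfixeq _ _ h2 hfix)
  · intro h2
    apply h1
    apply hmap
    apply hmap
    rw [← h2]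
    rw [comm_conj, comm_conj, comm_conj]
    ext x
    simp only [Submodule.mem_map]
    constructor
    · rintro ⟨_, ⟨_, ⟨y, hy, rfl⟩, rfl⟩, rfl⟩
      simpa [hE.cube d hd y] using hy
    · exact fun hx => ⟨_, ⟨_, ⟨x, hx, rfl⟩, rfl⟩, hE.cube d hd x⟩
  · exact fun h2 => h (hfixeq _ _ h2 hfix)
  · exact fun h2 => h1 (hmap _ _ h2.symm)
  · exact fun h2 => h (hconj _ (hfixeq _ _ h2 hfix))
  · exact fun h2 => h (hconj _ (hconj _ (hfixeq _ _ h2 hfix)))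
  · exact comm_conj_le_sup _ _ _ le_sup_right
  · exact comm_conj_le_sup _ _ _ (comm_conj_le_sup _ _ _ le_sup_right)

/-- Centralizing each other's lines is a symmetric relation on roots. -/
lemma fixes_symm (hd : d ∈ E) (he : e ∈ E) (h : Fixes d e) : Fixes e d := by
  by_contra hn
  obtain ⟨l, hl, h0⟩ := hE.exists_ne_zero hd
  have hne : comm e ≠ comm d := fun heq =>
    hE.not_fixes_self hd fun x hx => h x (heq ▸ hx)
  have hτ : ∀ x ∈ comm d, e x + x = 0 → x = 0 := fun x hx hx' =>
    hE.eq_zero_of_not_fixes he hd hn hx (eq_of_add_eq_zero' hx')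
  have hdl : d l ≠ 0 := by simpa using h0
  have hm : e l + l ∈ comm e := add_mem_comm e l
  have hm0 : e l + l ≠ 0 := fun h' => h0 (hτ l hl h')
  set m := e l + l with hmdef
  have hel : e l = l + m := by rw [hmdef]; have := two_add l; grind
  have hem := hE.rot he hm
  have hd2 := h m hm
  have hd3 := h (e m) (map_mem_comm hm)
  have h2m := two_add m
  have h2em := two_add (e m)
  -- If e fixes a nonzero vector of dg[V,d], then it centralizes that line, which lies in [V,e] +
  -- [V,d]; this contradicts `no_fixed_line` for e and d.
  have key : ∀ g ∈ E, ∀ x ∈ comm d, x ≠ 0 → e (d (g x)) = d (g x) →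
      comm (g * d * g⁻¹) ≤ comm e ⊔ comm d → False := by
    intro g hg x hx hx0 hfix hle
    have h1 := hE.conj g hg d hd
    refine hE.no_fixed_line he hd hne hn (hE.conj d hd _ h1) ?_
      (hE.fixes_of_fixed he (hE.conj d hd _ h1) (m := d (g x))
        (mem_comm_conj.2 (mem_comm_conj.2 hx)) (by simpa using hx0) hfix)
    rw [sup_comm] at hle ⊢
    exact comm_conj_le_sup _ _ _ hle
  -- With m = e l + l, this vector of [V,e] is 0, m, e m or e² m. The first two give e a nonzero
  -- fixed vector in [V,d]; the last two give it a fixed vector in the line of a conjugate, treated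
  -- by `key` with g = e⁻¹ and g = e.
  have hc : e (d l) + d l ∈ comm e := add_mem_comm e _
  have h2dl := two_add (d l)
  rcases hE.mem_cases he hm hm0 hc with h' | h' | h' | h'
  · exact hdl (hτ _ (map_mem_comm hl) h')
  · have h3 : d l + l = 0 := hτ _ ((comm d).add_mem (map_mem_comm hl) hl) (by
      rw [map_add]
      have : e (d l) = m + d l := by grind
      rw [this, hel]; have := two_add l; grind)
    exact h0 (hE.eq_zero_of_fixed hd hl (eq_of_add_eq_zero' h3))
  · refine key e⁻¹ (hE.inv e he) l hl h0 ?_ ?_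
    · have h4 : e (d l) = e m + d l := by grind
      rw [hE.inv_apply he, hel, map_add, hel]
      simp only [map_add, hd2, hd3, hem, h4]
      grind
    · have := comm_conj_le_sup e⁻¹ d d le_sup_right
      rwa [comm_inv] at this
  · refine key e he l hl h0 ?_ (comm_conj_le_sup e d d le_sup_right)
    have h4 : e (d l) = e (e m) + d l := by grind
    rw [hel]
    simp only [map_add, hd2, h4, hem]
    grind

/-- Thus d and e have the same fixed vectors in [V,d] + [V,e]. Of the four possible values of e l +
l in [V,e], the value e² m means that e fixes l + m. Zero would make e centralize [V,d]; m and e m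
put the d-fixed vector l + m on the image of [V,d] under e or e⁻¹, against `no_fixed_line`. -/
lemma fixed_symm (hd : d ∈ E) (he : e ∈ E) (h : ¬ Fixes d e) {l m : V} (hl : l ∈ comm d)
    (hm : m ∈ comm e) (hfix : d (l + m) = l + m) : e (l + m) = l + m := by
  by_cases hne : comm d = comm e
  · have : l + m = 0 := hE.eq_zero_of_fixed hd ((comm d).add_mem hl (hne ▸ hm)) hfix
    rw [this, map_zero]
  have h' : ¬ Fixes e d := fun h'' => h (hE.fixes_symm he hd h'')
  by_contra hcon
  have hem := hE.rot he hm
  have hc : e l + l ∈ comm e := add_mem_comm e _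
  have h2l := two_add l
  have h2m := two_add m
  have h2em := two_add (e m)
  have hl0 : l ≠ 0 := by
    rintro rfl
    rw [zero_add] at hfix hcon
    exact hcon (by rw [hE.eq_zero_of_not_fixes hd he h hm hfix, map_zero])
  have hm0 : m ≠ 0 := by
    rintro rfl
    rw [add_zero] at hfix
    exact hl0 (hE.eq_zero_of_fixed hd hl hfix)
  have key : ∀ g ∈ E, g l = l + m → comm (g * d * g⁻¹) ≤ comm d ⊔ comm e → False := by
    intro g hg hgl hle
    have h1 := hE.conj g hg d hd
    refine hE.no_fixed_line hd he hne h h1 hle (hE.fixes_of_fixed hd h1 (m := g l)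
        (mem_comm_conj.2 hl) (by simpa using hl0) ?_)
    rw [hgl, hfix]
  have hle := comm_conj_le_sup e d d le_sup_right
  have hle' := comm_conj_le_sup e⁻¹ d d le_sup_right
  rw [comm_inv] at hle'
  rw [sup_comm] at hle hle'
  rcases hE.mem_cases he hm hm0 hc with h' | h' | h' | h'
  · exact h (hE.fixes_symm he hd
      (hE.fixes_of_fixed he hd hl hl0 (eq_of_add_eq_zero' h')))
  · exact key e he (by grind) hle
  · apply key e⁻¹ (hE.inv e he) _ hle'
    have h4 : e l = e m + l := by grind
    rw [hE.inv_apply he, h4, map_add, h4, hem]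
    grind
  · apply hcon
    have h4 : e l = e (e m) + l := by grind
    rw [map_add, h4, hem]
    grind

end IsRootSet
end Local
-- Orientation: a consistent choice between a root and its inverse
section Orientation

variable {V : Type*} [AddCommGroup V] [Module (ZMod 2) V]

/-- `d` and `e` do not centralize each other's lines and induce the same orientation. -/
def Compat (d e : V ≃ₗ[ZMod 2] V) : Prop :=
  ¬ Fixes e d ∧ ∀ l ∈ comm d, e (d l) + d l = e (e l + l)

lemma conj_apply (g d : V ≃ₗ[ZMod 2] V) (x : V) : (g * d * g⁻¹) (g x) = g (d x) := by
  simp [LinearEquiv.mul_apply]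

lemma fixes_conj_iff {g d e : V ≃ₗ[ZMod 2] V} :
    Fixes (g * d * g⁻¹) (g * e * g⁻¹) ↔ Fixes d e := by
  constructor
  · intro h x hx
    have := h (g x) (mem_comm_conj.2 hx)
    rw [conj_apply] at this
    exact g.injective this
  · intro h x hx
    obtain ⟨y, rfl⟩ := g.surjective x
    rw [conj_apply, h y (mem_comm_conj.1 hx)]

lemma Compat.conj {d e : V ≃ₗ[ZMod 2] V} (h : Compat d e) (g : V ≃ₗ[ZMod 2] V) :
    Compat (g * d * g⁻¹) (g * e * g⁻¹) := by
  refine ⟨fun h' => h.1 (fixes_conj_iff.1 h'), fun x hx => ?_⟩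
  obtain ⟨y, rfl⟩ := g.surjective x
  simp only [conj_apply, ← map_add]
  rw [h.2 y (mem_comm_conj.1 hx)]

lemma fixes_inv_left {d e : V ≃ₗ[ZMod 2] V} : Fixes d⁻¹ e ↔ Fixes d e := by
  refine ⟨fun h x hx => ?_, fun h x hx => ?_⟩
  · conv_lhs => rw [← h x hx]
    rw [← LinearEquiv.mul_apply]; simp
  · conv_lhs => rw [← h x hx]
    rw [← LinearEquiv.mul_apply]; simp

lemma fixes_inv_right {d e : V ≃ₗ[ZMod 2] V} : Fixes d e⁻¹ ↔ Fixes d e := by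
  unfold Fixes
  rw [comm_inv]

lemma conj_eq_of_fixes {g d : V ≃ₗ[ZMod 2] V} (h : Fixes g d) (h' : Fixes d g) :
    g * d * g⁻¹ = d := by
  ext x
  obtain ⟨y, rfl⟩ := g.surjective x
  rw [conj_apply]
  have h1 := h (d y + y) (add_mem_comm _ _)
  have h2 := h' (g y + y) (add_mem_comm _ _)
  rw [map_add] at h1 h2
  have h3 := two_add (d y)
  have h4 := two_add y
  have h5 := two_add (g y)
  grind

namespace IsRootSet

variable {E : Set (V ≃ₗ[ZMod 2] V)} (hE : IsRootSet E) {d e f : V ≃ₗ[ZMod 2] V}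

include hE

lemma compat_inv_iff (he : e ∈ E) :
    Compat d e⁻¹ ↔ ¬ Fixes e d ∧ ∀ l ∈ comm d, e (d l) + d l = e (e (e l + l)) := by
  unfold Compat
  rw [fixes_inv_left]
  refine and_congr_right fun _ => forall₂_congr fun l hl => ?_
  have key : ∀ x, e⁻¹ x + x = e (e (e x + x)) := fun x => by
    rw [hE.inv_apply he, map_add, map_add, hE.cube e he, add_comm]
  rw [key, key, hE.inv_apply he]
  exact ⟨fun h => e.injective (e.injective h), fun h => by rw [h]⟩

/-- The map e - 1 is a bijection from [V,d] to [V,e]. It carries the action of d to an element of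
order three of GL₂(2), and there are only two of these: the actions of e and of e⁻¹. -/
lemma compat_or (hd : d ∈ E) (he : e ∈ E) (h : ¬ Fixes e d) : Compat d e ∨ Compat d e⁻¹ := by
  rw [hE.compat_inv_iff he]
  obtain ⟨l, hl, h0⟩ := hE.exists_ne_zero hd
  have hτ : ∀ x ∈ comm d, e x + x = 0 → x = 0 := fun x hx hx' =>
    hE.eq_zero_of_not_fixes he hd h hx (eq_of_add_eq_zero' hx')
  have hm : e l + l ∈ comm e := add_mem_comm e l
  have hm0 : e l + l ≠ 0 := fun h' => h0 (hτ l hl h')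
  have hdl := hE.rot hd hl
  have hdl0 : d l ≠ 0 := by simpa using h0
  have hcube := hE.cube d hd l
  have hrot := hE.rot he hm
  have h2 := two_add (e l + l)
  have h3 := two_add (e (e l + l))
  rcases hE.mem_cases he hm hm0 (add_mem_comm e (d l)) with h' | h' | h' | h'
  · exact absurd (hτ _ (map_mem_comm hl) h') hdl0
  · have h3 : d l + l = 0 := hτ _ ((comm d).add_mem (map_mem_comm hl) hl) (by
      rw [map_add]
      have : e (d l) + e l + (d l + l) = (e (d l) + d l) + (e l + l) := by abel
      rw [this, h', two_add])
    exact absurd (hE.eq_zero_of_fixed hd hl (eq_of_add_eq_zero' h3)) h0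
  · left
    refine ⟨h, hE.forall_of_invariant hd hl h0 (by simp) h' ?_ ?_⟩
    · rw [h', hdl, map_add e (d l) l]
      have : e (d l) + e l + (d l + l) = (e (d l) + d l) + (e l + l) := by abel
      rw [this, h', hrot]
    · rw [hcube, hdl, map_add e (d l) l]
      have : e (d l) + e l + (d l + l) = (e (d l) + d l) + (e l + l) := by abel
      rw [this, h', map_add, hrot]
      generalize e (e l + l) = y at *
      grind
  · right
    refine ⟨h, hE.forall_of_invariant hd hl h0 (by simp) h' ?_ ?_⟩
    · rw [h', hdl, map_add e (d l) l]
      have : e (d l) + e l + (d l + l) = (e (d l) + d l) + (e l + l) := by abel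
      rw [this, h', hE.cube e he, hrot]
      generalize e (e l + l) = y at *
      grind
    · rw [hcube, hdl, map_add e (d l) l]
      have : e (d l) + e l + (d l + l) = (e (d l) + d l) + (e l + l) := by abel
      rw [this, h', map_add, map_add, hE.cube e he, hrot]
      generalize e (e l + l) = y at *
      grind

lemma compat_self (hd : d ∈ E) : Compat d d :=
  ⟨hE.not_fixes_self hd, fun l _ => by rw [map_add]⟩

lemma not_fixes_symm (hd : d ∈ E) (he : e ∈ E) (h : ¬ Fixes d e) : ¬ Fixes e d :=
  fun h' => h (hE.fixes_symm he hd h')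

/-- Every vector of `[V, e]` has a partner in `[V, d]` with the same commutator. -/
lemma exists_partner (hd : d ∈ E) {m : V} : ∃ l ∈ comm d, d (l + m) = l + m := by
  refine ⟨d (d m + m), map_mem_comm (add_mem_comm d m), ?_⟩
  have h1 := hE.rot hd (add_mem_comm d m)
  have h2 := two_add (d m)
  rw [map_add, h1]
  generalize d (d m + m) = y at *
  grind

/-- By `fixed_symm` a partner l of m is the same for d and for e: l + m is fixed by both.
Compatibility turns the partnership of l and m into one of d l and e m, and reading this with d in
place of e gives the claim. -/
lemma compat_symm (hd : d ∈ E) (he : e ∈ E) (h : Compat d e) : Compat e d := by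
  refine ⟨hE.not_fixes_symm he hd h.1, fun m hm => ?_⟩
  obtain ⟨l, hl, hlm⟩ := hE.exists_partner hd (m := m)
  have h1 := hE.fixed_symm hd he (hE.not_fixes_symm he hd h.1) hl hm hlm
  have h2 : e (d l + e m) = d l + e m := by
    have h3 := h.2 l hl
    have h4 := two_add (e m)
    have h5 := two_add (d l)
    have h6 := two_add (l + m)
    have h8 : e l + l = e m + m := by
      rw [map_add] at h1
      have := two_add (e m)
      have := two_add l
      grind
    rw [h8, map_add] at h3
    rw [map_add]
    linear_combination (norm := module) h3 + two_add (e (e m)) - two_add (d l)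
  have h3 := hE.fixed_symm he hd h.1 (map_mem_comm hm) (map_mem_comm hl) (by rwa [add_comm])
  rw [map_add] at hlm h3
  have h4 := congrArg d hlm
  rw [map_add, map_add] at h4
  rw [map_add]
  have h5 := two_add (d l)
  have h6 := two_add (d (d l))
  have h7 := two_add (d m)
  have h8 := two_add (e m)
  grind

/-- Suppose e is compatible with f⁻¹ instead. On [V,e] put A = f - 1 and B = (f - 1)(d - 1). Then Ae
= f²A by assumption, Be = fB by the two compatibilities, and (f - 1)d = A + B. A nonzero m with Am =
Bm makes f fix dm, hence the whole line d[V,e]; so A and B also agree at em, which gives f²Am = fAm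
and Am = 0. -/
lemma compat_trans (hd : d ∈ E) (he : e ∈ E) (hf : f ∈ E) (h₁ : Compat e d) (h₂ : Compat d f)
    (h : ¬ Fixes f e) : Compat e f := by
  refine (hE.compat_or he hf h).resolve_right fun hc => ?_
  replace hc := ((hE.compat_inv_iff hf).1 hc).2
  obtain ⟨m, hm, h0⟩ := hE.exists_ne_zero he
  have hAe : ∀ m ∈ comm e, f (e m) + e m = f (f (f m + m)) := hc
  have hBe : ∀ m ∈ comm e, f (d (e m) + e m) + (d (e m) + e m)
      = f (f (d m + m) + (d m + m)) := fun m hm => by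
    rw [h₁.2 m hm, h₂.2 _ (add_mem_comm d m)]
  have hAB : ∀ m, f (d m) + d m = (f m + m) + (f (d m + m) + (d m + m)) := fun m => by
    rw [map_add]
    have := two_add m
    have := two_add (f m)
    grind
  have hA0 : ∀ m ∈ comm e, f m + m = 0 → m = 0 := fun m hm h' =>
    hE.eq_zero_of_not_fixes hf he h hm (eq_of_add_eq_zero' h')
  have hB0 : ∀ m ∈ comm e, f (d m + m) + (d m + m) = 0 → m = 0 := fun m hm h' =>
    hE.eq_zero_of_not_fixes hd he h₁.1 hm (eq_of_add_eq_zero'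
      (hE.eq_zero_of_not_fixes hf hd h₂.1 (add_mem_comm d m) (eq_of_add_eq_zero' h')))
  -- Am and Bm differ by a power of f. Since e multiplies A by f² and B by f, replacing m by em or
  -- e²m adjusts this power to any value.
  have hex : ∃ m ∈ comm e, m ≠ 0 ∧ f m + m = f (d m + m) + (d m + m) := by
    rcases hE.mem_cases hf (add_mem_comm f (d m + m)) (fun h' => h0 (hB0 m hm h'))
      (add_mem_comm f m) with h' | h' | h' | h'
    · exact absurd (hA0 m hm h') h0
    · exact ⟨m, hm, h0, h'⟩
    · refine ⟨e (e m), map_mem_comm (map_mem_comm hm), by simpa using h0, ?_⟩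
      rw [hAe _ (map_mem_comm hm), hAe _ hm, hBe _ (map_mem_comm hm), hBe _ hm, h']
      simp only [hE.cube f hf]
    · refine ⟨e m, map_mem_comm hm, by simpa using h0, ?_⟩
      rw [hAe _ hm, hBe _ hm, h']
      simp only [hE.cube f hf]
  obtain ⟨m, hm, h0, heq⟩ := hex
  have hfix : Fixes f (d * e * d⁻¹) := by
    refine hE.fixes_of_fixed hf (hE.conj d hd e he) (m := d m) (mem_comm_conj.2 hm)
      (by simpa using h0) (eq_of_add_eq_zero' ?_)
    rw [hAB, heq, two_add]
  have h1 := hfix (d (e m)) (mem_comm_conj.2 (map_mem_comm hm))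
  have h2 := hAB (e m)
  rw [h1, two_add, hAe m hm, hBe m hm, ← heq, ← map_add] at h2
  have h3 := hE.eq_zero_of_fixed hf (add_mem_comm f m)
    (eq_of_add_eq_zero' (f.injective (h2.symm.trans (map_zero f).symm)))
  exact h0 (hA0 m hm h3)

/-- The orientation of `e` agrees with that of the base element `d₀`. -/
def _root_.OrderThree.Pos (E : Set (V ≃ₗ[ZMod 2] V)) (d₀ e : V ≃ₗ[ZMod 2] V) : Prop :=
  Compat d₀ e ∨ Fixes d₀ e ∧ ∃ k ∈ E, Compat d₀ k ∧ Compat k e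

/-- If k fails, its conjugate by f works. Conjugation by f fixes d₀ and f, so both compatibilities
survive. If e centralized the lines of k and of fkf⁻¹, it would fix the nonzero vectors fx + x of
[V,f] with x in [V,k]. -/
lemma exists_conj_neighbour {d₀ k : V ≃ₗ[ZMod 2] V} (h₀ : d₀ ∈ E) (he : e ∈ E) (hf : f ∈ E)
    (hk : k ∈ E) (h₀f : Fixes d₀ f) (h₁ : Compat d₀ k) (h₂ : Compat k f) (hef : ¬ Fixes e f) :
    ∃ k' ∈ E, Compat d₀ k' ∧ Compat k' f ∧ ¬ Fixes e k' := by
  by_cases hke : Fixes e k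
  swap
  · exact ⟨k, hk, h₁, h₂, hke⟩
  refine ⟨f * k * f⁻¹, hE.conj f hf k hk, ?_, ?_, ?_⟩
  · have := h₁.conj f
    rwa [conj_eq_of_fixes (hE.fixes_symm h₀ hf h₀f) h₀f] at this
  · have := h₂.conj f
    rwa [show f * f * f⁻¹ = f by simp] at this
  · intro hfix
    obtain ⟨x, hx, hx0⟩ := hE.exists_ne_zero hk
    have h3 := hfix (f x) (mem_comm_conj.2 hx)
    have h4 := hke x hx
    have h5 : e (f x + x) = f x + x := by rw [map_add, h3, h4]
    have h6 := hE.eq_zero_of_not_fixes he hf hef (add_mem_comm f x) h5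
    exact hx0 (hE.eq_zero_of_not_fixes hf hk h₂.1 hx (eq_of_add_eq_zero' h6))

/-- Transitivity of `Compat` needs end points that do not centralize each other, so the chain from
d₀ to f is first rerouted through a neighbour k' not centralized by e. -/
lemma compat_of_pos_aux {d₀ : V ≃ₗ[ZMod 2] V} (h₀ : d₀ ∈ E) (he : e ∈ E) (hf : f ∈ E)
    (h₁ : Compat d₀ e) (h₂ : Pos E d₀ f) (h : ¬ Fixes e f) : Compat e f := by
  rcases h₂ with h₂ | ⟨h₂, k, hk, hk1, hk2⟩
  · exact hE.compat_trans h₀ he hf (hE.compat_symm h₀ he h₁) h₂ (hE.not_fixes_symm he hf h)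
  · obtain ⟨k', hk', h3, h4, h5⟩ := hE.exists_conj_neighbour h₀ he hf hk h₂ hk1 hk2 h
    have h6 : Compat k' e :=
      hE.compat_trans h₀ hk' he (hE.compat_symm h₀ hk' h3) h₁ h5
    exact hE.compat_trans hk' he hf (hE.compat_symm hk' he h6) h4 (hE.not_fixes_symm he hf h)

lemma compat_of_pos {d₀ : V ≃ₗ[ZMod 2] V} (h₀ : d₀ ∈ E) (he : e ∈ E) (hf : f ∈ E)
    (h₁ : Pos E d₀ e) (h₂ : Pos E d₀ f) (h : ¬ Fixes e f) : Compat e f := by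
  rcases h₁ with h₁ | ⟨h₁, k, hk, hk1, hk2⟩
  · exact hE.compat_of_pos_aux h₀ he hf h₁ h₂ h
  · obtain ⟨k', hk', h3, h4, h5⟩ := hE.exists_conj_neighbour h₀ hf he hk h₁ hk1 hk2
      (hE.not_fixes_symm he hf h)
    have h6 := hE.compat_of_pos_aux h₀ hk' hf h3 h₂ (hE.not_fixes_symm hf hk' h5)
    exact hE.compat_trans hk' he hf (hE.compat_symm hk' he h4) h6 (hE.not_fixes_symm he hf h)

lemma pos_or_of_not_fixes {d₀ : V ≃ₗ[ZMod 2] V} (h₀ : d₀ ∈ E) (he : e ∈ E) (hf : f ∈ E)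
    (h₁ : Pos E d₀ e) (h : ¬ Fixes e f) : Pos E d₀ f ∨ Pos E d₀ f⁻¹ := by
  by_cases h₀f : Fixes d₀ f
  swap
  · exact (hE.compat_or h₀ hf (hE.not_fixes_symm h₀ hf h₀f)).imp Or.inl Or.inl
  have key : ∀ k ∈ E, Compat d₀ k → ¬ Fixes k f → Pos E d₀ f ∨ Pos E d₀ f⁻¹ := by
    intro k hk hk1 hk2
    refine (hE.compat_or hk hf (hE.not_fixes_symm hk hf hk2)).imp (fun h' => ?_) fun h' => ?_
    · exact Or.inr ⟨h₀f, k, hk, hk1, h'⟩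
    · exact Or.inr ⟨fixes_inv_right.2 h₀f, k, hk, hk1, h'⟩
  rcases h₁ with h₁ | ⟨h₁, k, hk, hk1, hk2⟩
  · exact key e he h₁ h
  · obtain ⟨k', hk', h3, h4, h5⟩ := hE.exists_conj_neighbour h₀ hf he hk h₁ hk1 hk2
      (hE.not_fixes_symm he hf h)
    exact key k' hk' h3 (hE.not_fixes_symm hf hk' h5)

end IsRootSet
end Orientation
-- The field with four elements
section FieldFour

lemma F4.two_eq_zero : (2 : F4) = 0 := CharTwo.two_eq_zero

lemma F4.natCard : Nat.card F4 = 4 := by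
  rw [GaloisField.card 2 2 (by norm_num)]
  norm_num

lemma F4.pow_four (x : F4) : x ^ 4 = x := by
  have := Fintype.ofFinite F4
  have := FiniteField.pow_card x
  rwa [← Nat.card_eq_fintype_card, F4.natCard] at this

lemma F4.pow_three {x : F4} (h : x ≠ 0) : x ^ 3 = 1 := by
  have h1 := F4.pow_four x
  apply mul_left_cancel₀ h
  linear_combination h1

lemma F4.quadratic {a : F4} (h0 : a ≠ 0) (h1 : a ≠ 1) : a ^ 2 = a + 1 := by
  have h := F4.pow_three h0
  have h2 : (a - 1) * (a ^ 2 - (a + 1)) = 0 := by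
    linear_combination h - (a ^ 2 - 1) * F4.two_eq_zero
  rcases mul_eq_zero.1 h2 with h3 | h3
  · exact absurd (sub_eq_zero.1 h3) h1
  · exact sub_eq_zero.1 h3

lemma F4.exists_generator : ∃ a : F4, a ≠ 0 ∧ a ≠ 1 := by
  classical
  by_contra! h
  have := Fintype.ofFinite F4
  have h1 := F4.natCard
  have h2 : (Finset.univ : Finset F4) ⊆ {0, 1} := fun x _ => by
    by_cases hx : x = 0
    · simp [hx]
    · simp [h x hx]
  have h3 := Finset.card_le_card h2
  rw [Finset.card_univ, ← Nat.card_eq_fintype_card, h1] at h3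
  have h4 : ({0, 1} : Finset F4).card ≤ 2 := Finset.card_le_two
  omega

lemma F4.cases {a : F4} (h0 : a ≠ 0) (h1 : a ≠ 1) (x : F4) :
    x = 0 ∨ x = 1 ∨ x = a ∨ x = a ^ 2 := by
  by_cases hx0 : x = 0
  · exact Or.inl hx0
  by_cases hx1 : x = 1
  · exact Or.inr (Or.inl hx1)
  have h2 := F4.quadratic h0 h1
  have h3 := F4.quadratic hx0 hx1
  have h4 : (x - a) * (x - a ^ 2) = 0 := by
    have h5 := F4.pow_three h0
    linear_combination h3 - x * h2 + h5 + (1 - a * x) * F4.two_eq_zero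
  rcases mul_eq_zero.1 h4 with h | h
  · exact Or.inr (Or.inr (Or.inl (sub_eq_zero.1 h)))
  · exact Or.inr (Or.inr (Or.inr (sub_eq_zero.1 h)))

/-- Both evaluations of polynomials over F₂ kill X² + X + 1. A polynomial vanishing at a has
remainder bX + c with ba + c = 0, hence b = c = 0 as a is not in F₂; so evaluation at Ω factors
through evaluation at a. -/
lemma F4.exists_ringHom {R : Type*} [Ring R] [Algebra (ZMod 2) R] (Ω : R) (hΩ : Ω ^ 2 + Ω + 1 = 0)
    {a : F4} (h0 : a ≠ 0) (h1 : a ≠ 1) : ∃ φ : F4 →+* R, φ a = Ω := by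
  have hq := F4.quadratic h0 h1
  let f : Polynomial (ZMod 2) →+* F4 := (Polynomial.aeval a).toRingHom
  let g : Polynomial (ZMod 2) →+* R := (Polynomial.aeval Ω).toRingHom
  have hf : Function.Surjective f := fun x => by
    rcases F4.cases h0 h1 x with rfl | rfl | rfl | rfl
    · exact ⟨0, map_zero _⟩
    · exact ⟨1, map_one _⟩
    · exact ⟨Polynomial.X, by simp [f]⟩
    · exact ⟨Polynomial.X ^ 2, by simp [f]⟩
  have hmonic : (Polynomial.X ^ 2 + Polynomial.X + 1 : Polynomial (ZMod 2)).Monic := by monicity!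
  have hker : RingHom.ker f ≤ RingHom.ker g := by
    intro p hp
    rw [RingHom.mem_ker] at hp ⊢
    have hdecomp := Polynomial.modByMonic_add_div p
      (Polynomial.X ^ 2 + Polynomial.X + 1 : Polynomial (ZMod 2))
    have hdeg : (p %ₘ (Polynomial.X ^ 2 + Polynomial.X + 1)).natDegree ≤ 1 := by
      have hn : (Polynomial.X ^ 2 + Polynomial.X + 1 : Polynomial (ZMod 2)).natDegree = 2 := by
        compute_degree!
      have := Polynomial.natDegree_modByMonic_lt p hmonic (by
        intro h; rw [h, Polynomial.natDegree_one] at hn; omega)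
      omega
    obtain ⟨b, c, hbc⟩ := Polynomial.exists_eq_X_add_C_of_natDegree_le_one hdeg
    rw [hbc] at hdecomp
    have hfp : f p = algebraMap (ZMod 2) F4 b * a + algebraMap (ZMod 2) F4 c := by
      rw [← hdecomp]
      simp only [f, AlgHom.toRingHom_eq_coe, RingHom.coe_coe, map_add, map_mul, map_pow, map_one,
        Polynomial.aeval_X, Polynomial.aeval_C]
      rw [hq]
      linear_combination ((Polynomial.aeval a) (p /ₘ (Polynomial.X ^ 2 + Polynomial.X + 1))) *
        (a + 1) * F4.two_eq_zero
    have hgp : g p = algebraMap (ZMod 2) R b * Ω + algebraMap (ZMod 2) R c := by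
      rw [← hdecomp]
      simp only [g, AlgHom.toRingHom_eq_coe, RingHom.coe_coe, map_add, map_mul, map_pow, map_one,
        Polynomial.aeval_X, Polynomial.aeval_C, hΩ]
      simp
    rw [hp] at hfp
    have h01 : ∀ z : ZMod 2, z = 0 ∨ z = 1 := by decide
    rw [hgp]
    rcases h01 b with rfl | rfl <;> rcases h01 c with rfl | rfl
    · simp
    · simp at hfp
    · simp only [map_one, map_zero, one_mul, add_zero] at hfp
      exact absurd hfp.symm h0
    · simp only [map_one, one_mul] at hfp
      exact absurd (by linear_combination - hfp - F4.two_eq_zero) h1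
  refine ⟨RingHom.liftOfSurjective f hf ⟨g, hker⟩, ?_⟩
  have hX : f Polynomial.X = a := by simp [f]
  have := RingHom.liftOfRightInverse_comp_apply f (Function.surjInv hf)
    (Function.rightInverse_surjInv hf) ⟨g, hker⟩ Polynomial.X
  rw [hX] at this
  refine this.trans ?_
  simp [g]

end FieldFour

/-! ### The F4-structure on V -/

section Scalars

variable {V : Type*} [AddCommGroup V] [Module (ZMod 2) V]

/-- A root set that spans `V`, has no nonzero fixed vectors and is connected. -/
structure IsConnectedRootSet (E : Set (V ≃ₗ[ZMod 2] V)) : Prop extends IsRootSet E where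
  span : ⨆ d ∈ E, comm d = ⊤
  cent : ∀ x, (∀ d ∈ E, d x = x) → x = 0
  nonempty : E.Nonempty
  conn : ∀ d₀ ∈ E, ∀ Q : (V ≃ₗ[ZMod 2] V) → Prop, Q d₀ →
    (∀ d ∈ E, ∀ e ∈ E, Q d → ¬ Fixes d e → Q e) → ∀ e ∈ E, Q e

namespace IsConnectedRootSet

variable {E : Set (V ≃ₗ[ZMod 2] V)} (hE : IsConnectedRootSet E)

include hE

lemma exists_orientation : ∃ P ⊆ E, (∀ e ∈ E, e ∈ P ∨ e⁻¹ ∈ P) ∧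
    ∀ e ∈ P, ∀ f ∈ P, ¬ Fixes e f → Compat e f := by
  obtain ⟨d₀, h₀⟩ := hE.nonempty
  have hR := hE.toIsRootSet
  refine ⟨{e ∈ E | Pos E d₀ e}, fun e he => he.1, fun e he => ?_,
    fun e he f hf => hR.compat_of_pos h₀ he.1 hf.1 he.2 hf.2⟩
  refine (hE.conn d₀ h₀ (fun e => Pos E d₀ e ∨ Pos E d₀ e⁻¹) (Or.inl (Or.inl (hR.compat_self h₀)))
    ?_ e he).imp (fun h => ⟨he, h⟩) (fun h => ⟨hR.inv e he, h⟩)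
  rintro e he f hf (h | h) hn
  · exact hR.pos_or_of_not_fixes h₀ he hf h hn
  · exact hR.pos_or_of_not_fixes h₀ (hR.inv e he) hf h (by rwa [fixes_inv_left])

lemma span_induction {p : V → Prop} (h0 : p 0) (hadd : ∀ x y, p x → p y → p (x + y))
    (hl : ∀ d ∈ E, ∀ x ∈ comm d, p x) (x : V) : p x := by
  have hx : x ∈ ⨆ d ∈ E, comm d := by rw [hE.span]; trivial
  refine Submodule.iSup_induction _ hx (motive := p) (fun d y hy => ?_) h0 hadd
  by_cases hd : d ∈ E
  · rw [iSup_pos hd] at hy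
    exact hl d hd y hy
  · rw [iSup_neg hd] at hy
    rw [(Submodule.mem_bot _).1 hy]
    exact h0

/-- The vector Ωx is characterized by (e - 1)Ωx = e(e - 1)x for all positively oriented e. It is
unique because no nonzero vector is fixed by all roots. On a line [V,d] with d positive,
compatibility says that d l is a solution, and solutions add, so spanning gives existence. Linearity
and the quadratic relation follow from uniqueness. -/
lemma exists_omega : ∃ Ω : V →ₗ[ZMod 2] V, (∀ x, Ω (Ω x) + Ω x + x = 0) ∧
    (∀ e ∈ E, ∀ x, e (Ω x) = Ω (e x)) ∧
    ∀ e ∈ E, (∀ l ∈ comm e, e l = Ω l) ∨ ∀ l ∈ comm e, e l = Ω (Ω l) := by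
  obtain ⟨P, hPE, hP, hc⟩ := hE.exists_orientation
  have hR := hE.toIsRootSet
  have huniq : ∀ x, (∀ e ∈ P, e x = x) → x = 0 := fun x hx => hE.cent x fun e he => by
    rcases hP e he with h | h
    · exact hx e h
    · have h1 := hx _ h
      rw [hR.inv_apply he] at h1
      apply e.injective
      apply e.injective
      rw [hR.cube e he, h1]
  have hline : ∀ d ∈ P, ∀ l ∈ comm d, ∀ e ∈ P, e (d l) + d l = e (e l + l) := by
    intro d hd l hl e he
    by_cases hn : Fixes d e
    · have := hR.fixes_symm (hPE hd) (hPE he) hn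
      rw [this l hl, this _ (map_mem_comm hl), two_add, two_add, map_zero]
    · exact (hc d hd e he hn).2 l hl
  have hex : ∀ x, ∃ y, ∀ e ∈ P, e y + y = e (e x + x) := by
    refine hE.span_induction ⟨0, by simp⟩ ?_ ?_
    · rintro x x' ⟨y, hy⟩ ⟨y', hy'⟩
      refine ⟨y + y', fun e he => ?_⟩
      rw [map_add, show e y + e y' + (y + y') = (e y + y) + (e y' + y') by abel, hy e he, hy' e he,
        ← map_add, map_add e x x']
      congr 1
      abel
    · intro d hd l hl
      rcases hP d hd with h | h
      · exact ⟨d l, hline d h l hl⟩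
      · exact ⟨d⁻¹ l, hline _ h l (by rwa [comm_inv])⟩
  choose Ω hΩ using hex
  have hu : ∀ x y, (∀ e ∈ P, e y + y = e (e x + x)) → Ω x = y := fun x y hy => by
    apply eq_of_add_eq_zero'
    refine huniq _ fun e he => eq_of_add_eq_zero' ?_
    rw [map_add, show e (Ω x) + e y + (Ω x + y) = (e (Ω x) + Ω x) + (e y + y) by abel,
      hΩ x e he, hy e he, two_add]
  have hadd : ∀ x y, Ω (x + y) = Ω x + Ω y := fun x y => hu _ _ fun e he => by
    rw [map_add, show e (Ω x) + e (Ω y) + (Ω x + Ω y) = (e (Ω x) + Ω x) + (e (Ω y) + Ω y) by abel,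
      hΩ x e he, hΩ y e he, ← map_add, map_add e x y]
    congr 1
    abel
  let Ωh : V →+ V := ⟨⟨Ω, by simpa using hadd 0 0⟩, hadd⟩
  have hl : ∀ e ∈ P, ∀ l ∈ comm e, Ω l = e l := fun e he l hl => hu _ _ (hline e he l hl)
  refine ⟨Ωh.toZModLinearMap 2, ?_, ?_, ?_⟩
  · intro x
    change Ω (Ω x) + Ω x + x = 0
    refine huniq _ fun e he => eq_of_add_eq_zero' ?_
    have h1 := hR.rot (hPE he) (add_mem_comm e x)
    have h2 : e (Ω (Ω x) + Ω x + x) + (Ω (Ω x) + Ω x + x) =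
        (e (Ω (Ω x)) + Ω (Ω x)) + (e (Ω x) + Ω x) + (e x + x) := by
      rw [map_add, map_add]; abel
    rw [h2, hΩ _ e he, hΩ _ e he, h1, show ∀ a b : V, a + b + a + b = (a + b) + (a + b) by
      intros; abel, two_add]
  · intro e he x
    change e (Ω x) = Ω (e x)
    have key : ∀ e ∈ P, ∀ x, e (Ω x) = Ω (e x) := fun e he x => by
      have h1 : e x = (e x + x) + x := by rw [add_assoc, two_add, add_zero]
      rw [h1, hadd, hl e he _ (add_mem_comm e x), ← hΩ x e he, add_assoc, two_add, add_zero]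
    rcases hP e he with h | h
    · exact key e h x
    · have h1 := key _ h (e x)
      rw [show e⁻¹ (e x) = x by rw [← LinearEquiv.mul_apply]; simp] at h1
      rw [← h1, ← LinearEquiv.mul_apply]
      simp
  · intro e he
    change (∀ l ∈ comm e, e l = Ω l) ∨ ∀ l ∈ comm e, e l = Ω (Ω l)
    rcases hP e he with h | h
    · exact Or.inl fun l hl' => (hl e h l hl').symm
    · right
      intro l hl'
      have h1 : ∀ l ∈ comm e, Ω l = e⁻¹ l := fun l hl' => hl _ h l (by rwa [comm_inv])
      have h2 : e⁻¹ l ∈ comm e := by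
        rw [← comm_inv]
        exact map_mem_comm (by rwa [comm_inv])
      rw [h1 l hl', h1 _ h2, hR.inv_apply he, hR.inv_apply he, hR.cube e he]

/-- The scalar action of the field with four elements. -/
lemma exists_module : ∃ _ : Module F4 V,
    (∀ e ∈ E, ∀ (a : F4) (x : V), e (a • x) = a • e x) ∧
    ∀ e ∈ E, ∃ a : F4, a ≠ 0 ∧ a ≠ 1 ∧ ∀ l ∈ comm e, e l = a • l := by
  obtain ⟨Ω, hΩ, hcomm, hline⟩ := hE.exists_omega
  obtain ⟨a, h0, h1⟩ := F4.exists_generator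
  obtain ⟨φ, hφ⟩ := F4.exists_ringHom (R := Module.End (ZMod 2) V) Ω (by
    ext x; simpa [pow_two] using hΩ x) h0 h1
  refine ⟨Module.compHom V φ, ?_, ?_⟩
  · intro e he b x
    change e (φ b x) = φ b (e x)
    rcases F4.cases h0 h1 b with rfl | rfl | rfl | rfl
    · simp
    · simp
    · rw [hφ]
      exact hcomm e he x
    · rw [map_pow, hφ, pow_two]
      change e (Ω (Ω x)) = Ω (Ω (e x))
      rw [hcomm e he, hcomm e he]
  · intro e he
    rcases hline e he with h | h
    · refine ⟨a, h0, h1, fun l hl => ?_⟩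
      change e l = φ a l
      rw [hφ, h l hl]
    · refine ⟨a ^ 2, pow_ne_zero _ h0, ?_, fun l hl => ?_⟩
      · rw [F4.quadratic h0 h1]
        intro h2
        exact h0 (by linear_combination h2)
      · change e l = φ (a ^ 2) l
        rw [map_pow, hφ, pow_two, h l hl]
        rfl

end IsConnectedRootSet
end Scalars
-- The invariant Hermitian form
section Form

variable {V : Type*} [AddCommGroup V] [Module (ZMod 2) V] [Module F4 V]

lemma F4.add_self (x : F4) : x + x = 0 := CharTwo.add_self_eq_zero x

lemma F4.eq_of_add_eq_zero {x y : F4} (h : x + y = 0) : x = y := CharTwo.add_eq_zero.1 h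

lemma F4.add_sq (x y : F4) : (x + y) ^ 2 = x ^ 2 + y ^ 2 := CharTwo.add_sq x y

lemma F4.add_one_ne {a : F4} (h0 : a ≠ 0) (h1 : a ≠ 1) : a + 1 ≠ 0 ∧ a + 1 ≠ 1 :=
  ⟨fun h => h1 (F4.eq_of_add_eq_zero h), fun h => h0 (by linear_combination h)⟩

/-- A set of roots that are linear over the field with four elements and act by scalars on
their commutator spaces. -/
structure IsLinearRootSet (E : Set (V ≃ₗ[ZMod 2] V)) : Prop extends IsConnectedRootSet E where
  linear : ∀ e ∈ E, ∀ (a : F4) (x : V), e (a • x) = a • e x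
  scalar : ∀ e ∈ E, ∃ a : F4, a ≠ 0 ∧ a ≠ 1 ∧ ∀ l ∈ comm e, e l = a • l

/-- `e` is the reflection with center `v` whose axis is the kernel of `φ`. -/
def IsRootWith (e : V ≃ₗ[ZMod 2] V) (v : V) (φ : V →ₗ[F4] F4) : Prop :=
  v ∈ comm e ∧ v ≠ 0 ∧ φ v = 1 ∧ ∃ a : F4, a ≠ 0 ∧ a ≠ 1 ∧ ∀ w, e w = w + (a * φ w) • v

namespace IsLinearRootSet

variable {E : Set (V ≃ₗ[ZMod 2] V)} (hE : IsLinearRootSet E)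

include hE

lemma exists_smul_eq {e : V ≃ₗ[ZMod 2] V} (he : e ∈ E) {l x : V} (hl : l ∈ comm e) (h0 : l ≠ 0)
    (hx : x ∈ comm e) : ∃ c : F4, x = c • l := by
  obtain ⟨a, -, -, ha⟩ := hE.scalar e he
  rcases hE.mem_cases he hl h0 hx with rfl | rfl | rfl | rfl
  · exact ⟨0, by simp⟩
  · exact ⟨1, by simp⟩
  · exact ⟨a, ha l hl⟩
  · exact ⟨a * a, by rw [ha _ (map_mem_comm hl), ha l hl, mul_smul]⟩

lemma smul_mem_comm {e : V ≃ₗ[ZMod 2] V} (he : e ∈ E) {l : V} (hl : l ∈ comm e) (c : F4) :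
    c • l ∈ comm e := by
  obtain ⟨y, rfl⟩ := mem_comm.1 hl
  exact mem_comm.2 ⟨c • y, by rw [hE.linear e he, smul_add]⟩

lemma exists_isRootWith {e : V ≃ₗ[ZMod 2] V} (he : e ∈ E) {v : V} (hv : v ∈ comm e) (h0 : v ≠ 0) :
    ∃ φ : V →ₗ[F4] F4, IsRootWith e v φ := by
  have hex : ∀ w, ∃ c : F4, e w + w = c • v := fun w =>
    hE.exists_smul_eq he hv h0 (add_mem_comm e w)
  choose c hc using hex
  have hinj : ∀ a b : F4, a • v = b • v → a = b := fun a b h => smul_left_injective F4 h0 h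
  let ψ : V →ₗ[F4] F4 :=
    { toFun := c
      map_add' := fun x y => hinj _ _ (by
        rw [add_smul, ← hc, ← hc, ← hc, map_add]; abel)
      map_smul' := fun a x => hinj _ _ (by
        rw [RingHom.id_apply, smul_eq_mul, mul_smul, ← hc, ← hc, hE.linear e he, smul_add]) }
  obtain ⟨a, ha0, ha1, ha⟩ := hE.scalar e he
  have hcv : c v = a + 1 := hinj _ _ (by rw [← hc, ha v hv, add_smul, one_smul])
  obtain ⟨h1, h2⟩ := F4.add_one_ne ha0 ha1
  refine ⟨(a + 1)⁻¹ • ψ, hv, h0, ?_, a + 1, h1, h2, fun w => ?_⟩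
  · change (a + 1)⁻¹ * c v = 1
    rw [hcv, inv_mul_cancel₀ h1]
  · change e w = w + ((a + 1) * ((a + 1)⁻¹ * c w)) • v
    rw [mul_inv_cancel_left₀ h1, ← hc, add_comm, add_assoc, two_add, add_zero]

omit hE in
lemma _root_.OrderThree.IsRootWith.fixed_iff {e : V ≃ₗ[ZMod 2] V} {v : V} {φ : V →ₗ[F4] F4}
    (h : IsRootWith e v φ) (w : V) : e w = w ↔ φ w = 0 := by
  obtain ⟨-, h0, -, a, ha, -, he⟩ := h
  rw [he, add_eq_left, smul_eq_zero, mul_eq_zero]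
  simp [ha, h0]

/-- If e and f do not centralize each other's lines, a vector cv + u fixed by both exists by
`fixed_symm`. It yields c = φ(u) and cψ(v) = 1, and inverses of nonzero scalars are squares in F4.
-/
lemma isRootWith_symm {e f : V ≃ₗ[ZMod 2] V} (he : e ∈ E) (hf : f ∈ E) {v u : V}
    {φ ψ : V →ₗ[F4] F4} (h₁ : IsRootWith e v φ) (h₂ : IsRootWith f u ψ) :
    φ u = ψ v ^ 2 := by
  by_cases hn : Fixes e f
  · have hn' := hE.fixes_symm he hf hn
    rw [(h₁.fixed_iff u).1 (hn u h₂.1), (h₂.fixed_iff v).1 (hn' v h₁.1)]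
    simp
  · obtain ⟨l, hl, hlu⟩ := hE.exists_partner he (m := u)
    have hlu' := hE.fixed_symm he hf hn hl h₂.1 hlu
    obtain ⟨c, rfl⟩ := hE.exists_smul_eq he h₁.1 h₁.2.1 hl
    rw [h₁.fixed_iff, map_add, map_smul, h₁.2.2.1, smul_eq_mul, mul_one] at hlu
    rw [h₂.fixed_iff, map_add, map_smul, h₂.2.2.1, smul_eq_mul] at hlu'
    have h3 := F4.eq_of_add_eq_zero hlu
    have h4 := F4.eq_of_add_eq_zero hlu'
    have h5 : ψ v ≠ 0 := fun h => by rw [h, mul_zero] at h4; exact zero_ne_one h4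
    rw [← h3]
    have h6 := F4.pow_three h5
    linear_combination (ψ v ^ 2) * h4 - c * h6

lemma ext_of_roots {ψ ψ' : V →ₗ[F4] F4}
    (h : ∀ e ∈ E, ∀ v φ, IsRootWith e v φ → ψ v = ψ' v) : ψ = ψ' := by
  ext x
  refine hE.span_induction (p := fun x => ψ x = ψ' x) (by simp)
    (fun x y hx hy => by rw [map_add, map_add, hx, hy]) (fun e he v hv => ?_) x
  by_cases h0 : v = 0
  · simp [h0]
  · obtain ⟨φ, hφ⟩ := hE.exists_isRootWith he hv h0
    exact h e he v φ hφ

/-- The invariant Hermitian form of a connected root set. -/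
lemma exists_form : ∃ h : V →ₗ[F4] V →ₛₗ[frobenius F4 2] F4, IsNondegHermitian h ∧
    ∀ e ∈ E, ∀ v ∈ comm e, v ≠ 0 → h v v = 1 ∧
      ∃ a : F4, a ≠ 0 ∧ a ≠ 1 ∧ ∀ w, e w = w + (a * h w v) • v := by
  -- The functional ψ is the future h(·,y). Its values on line vectors are dictated by Hermitian
  -- symmetry; the condition is additive in y and holds on lines by `isRootWith_symm`.
  have hex : ∀ y, ∃ ψ : V →ₗ[F4] F4, ∀ e ∈ E, ∀ v φ, IsRootWith e v φ → ψ v = φ y ^ 2 := by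
    refine hE.span_induction ⟨0, by simp⟩ ?_ ?_
    · rintro x y ⟨ψ, hψ⟩ ⟨ψ', hψ'⟩
      refine ⟨ψ + ψ', fun e he v φ h => ?_⟩
      rw [LinearMap.add_apply, hψ e he v φ h, hψ' e he v φ h, map_add, F4.add_sq]
    · intro f hf u hu
      by_cases h0 : u = 0
      · exact ⟨0, by simp [h0]⟩
      · obtain ⟨ψ, hψ⟩ := hE.exists_isRootWith hf hu h0
        exact ⟨ψ, fun e he v φ h => hE.isRootWith_symm hf he hψ h⟩
  choose ψ hψ using hex
  have huniq : ∀ y ψ', (∀ e ∈ E, ∀ v φ, IsRootWith e v φ → ψ' v = φ y ^ 2) → ψ y = ψ' :=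
    fun y ψ' h' => hE.ext_of_roots fun e he v φ h => by rw [hψ y e he v φ h, h' e he v φ h]
  let h : V →ₗ[F4] V →ₛₗ[frobenius F4 2] F4 :=
    LinearMap.mk₂'ₛₗ (RingHom.id F4) (frobenius F4 2) (fun x y => ψ y x)
      (fun x y z => map_add _ _ _) (fun c x y => by simp)
      (fun x y z => by
        rw [huniq (y + z) (ψ y + ψ z) fun e he v φ h => by
          rw [LinearMap.add_apply, hψ y e he v φ h, hψ z e he v φ h, map_add, F4.add_sq]]
        rfl)
      (fun c x y => by
        rw [huniq (c • y) (c ^ 2 • ψ y) fun e he v φ h => by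
          rw [LinearMap.smul_apply, hψ y e he v φ h, map_smul, smul_eq_mul, smul_eq_mul, mul_pow]]
        rfl)
  have happly : ∀ x y, h x y = ψ y x := fun x y => rfl
  have hroot : ∀ e ∈ E, ∀ v φ, IsRootWith e v φ → ∀ w, h w v = φ w := fun e he v φ h' w => by
    rw [happly, huniq v φ fun f hf u χ hχ => hE.isRootWith_symm he hf h' hχ]
  have hherm : ∀ x y, h y x = h x y ^ 2 := by
    refine hE.span_induction (fun y => by simp) ?_ ?_
    · intro x x' hx hx' y
      rw [map_add, hx, hx', map_add, LinearMap.add_apply, F4.add_sq]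
    · intro e he v hv y
      by_cases h0 : v = 0
      · simp [h0]
      · obtain ⟨φ, hφ⟩ := hE.exists_isRootWith he hv h0
        rw [hroot e he v φ hφ, happly, hψ y e he v φ hφ, ← pow_mul, F4.pow_four]
  refine ⟨h, ⟨hherm, fun x hx => ?_⟩, ?_⟩
  · refine hE.cent x fun e he => ?_
    obtain ⟨v, hv, h0⟩ := hE.exists_ne_zero he
    obtain ⟨φ, hφ⟩ := hE.exists_isRootWith he hv h0
    rw [hφ.fixed_iff, ← hroot e he v φ hφ]
    exact hx v
  · intro e he v hv h0
    obtain ⟨φ, hφ⟩ := hE.exists_isRootWith he hv h0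
    refine ⟨by rw [hroot e he v φ hφ, hφ.2.2.1], ?_⟩
    obtain ⟨a, ha0, ha1, ha⟩ := hφ.2.2.2
    exact ⟨a, ha0, ha1, fun w => by rw [ha, hroot e he v φ hφ]⟩

end IsLinearRootSet
end Form
-- Scalars in the form
section FormRules

variable {V : Type*} [AddCommGroup V] [Module F4 V]

lemma form_smul_right (h : V →ₗ[F4] V →ₛₗ[frobenius F4 2] F4) (x y : V) (c : F4) :
    h x (c • y) = c ^ 2 * h x y := by
  rw [map_smulₛₗ, frobenius_def, smul_eq_mul]

lemma form_smul_left (h : V →ₗ[F4] V →ₛₗ[frobenius F4 2] F4) (x y : V) (c : F4) :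
    h (c • x) y = c * h x y := by
  rw [map_smul, LinearMap.smul_apply, smul_eq_mul]

lemma form_add_left (h : V →ₗ[F4] V →ₛₗ[frobenius F4 2] F4) (x y z : V) :
    h (x + y) z = h x z + h y z := by
  rw [map_add, LinearMap.add_apply]

lemma exists_smul_form_eq {h : V →ₗ[F4] V →ₛₗ[frobenius F4 2] F4} {x y : V} (hxy : h x y ≠ 0)
    {c : F4} (hc : c ≠ 0) : ∃ b : F4, b ≠ 0 ∧ h x (b • y) = c := by
  refine ⟨(c * (h x y)⁻¹) ^ 2, pow_ne_zero _ (mul_ne_zero hc (inv_ne_zero hxy)), ?_⟩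
  rw [form_smul_right, ← pow_mul, F4.pow_four, inv_mul_cancel_right₀ hxy]

end FormRules

/-! ### Line vectors are the vectors of norm one -/

section Classification

variable {V : Type*} [AddCommGroup V] [Module (ZMod 2) V] [Module F4 V]

/-- A linear root set together with an invariant Hermitian form. -/
structure IsUnitaryRootSet (h : V →ₗ[F4] V →ₛₗ[frobenius F4 2] F4)
    (E : Set (V ≃ₗ[ZMod 2] V)) : Prop extends IsLinearRootSet E where
  nondeg : IsNondegHermitian h
  root : ∀ e ∈ E, ∀ v ∈ comm e, v ≠ 0 → h v v = 1 ∧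
      ∃ a : F4, a ≠ 0 ∧ a ≠ 1 ∧ ∀ w, e w = w + (a * h w v) • v

/-- The nonzero vectors of the lines `[V, e]`. -/
def IsLineVector (E : Set (V ≃ₗ[ZMod 2] V)) (v : V) : Prop := ∃ e ∈ E, v ∈ comm e ∧ v ≠ 0

/-- The nonzero vectors of the singular lines. -/
def IsSingularVector (h : V →ₗ[F4] V →ₛₗ[frobenius F4 2] F4) (E : Set (V ≃ₗ[ZMod 2] V))
    (s : V) : Prop :=
  s ≠ 0 ∧ ∃ l m, IsLineVector E l ∧ IsLineVector E m ∧ h l m = 1 ∧ s = l + m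

namespace IsUnitaryRootSet

variable {h : V →ₗ[F4] V →ₛₗ[frobenius F4 2] F4} {E : Set (V ≃ₗ[ZMod 2] V)}
  (hE : IsUnitaryRootSet h E) {u v : V}

include hE

lemma herm (x y : V) : h y x = h x y ^ 2 := hE.nondeg.hermitian x y

lemma form_eq_zero_symm {x y : V} (hxy : h x y = 0) : h y x = 0 := by
  rw [hE.herm x y, hxy]; simp

lemma form_self (x : V) : h x x = 0 ∨ h x x = 1 := by
  have h1 := hE.herm x x
  have h2 : h x x * (h x x - 1) = 0 := by linear_combination - h1
  rcases mul_eq_zero.1 h2 with h3 | h3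
  · exact Or.inl h3
  · exact Or.inr (sub_eq_zero.1 h3)

lemma lineVector_smul (hv : IsLineVector E v) {c : F4} (hc : c ≠ 0) : IsLineVector E (c • v) := by
  obtain ⟨e, he, hv, h0⟩ := hv
  exact ⟨e, he, hE.smul_mem_comm he hv c, smul_ne_zero hc h0⟩

lemma lineVector_form (hv : IsLineVector E v) : h v v = 1 := by
  obtain ⟨e, he, hv, h0⟩ := hv
  exact (hE.root e he v hv h0).1

/-- Both reflections with center a line vector are roots. -/
lemma exists_reflection (hv : IsLineVector E v) {a : F4} (h0 : a ≠ 0) (h1 : a ≠ 1) :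
    ∃ e ∈ E, v ∈ comm e ∧ ∀ w, e w = w + (a * h w v) • v := by
  have hvv := hE.lineVector_form hv
  obtain ⟨e, he, hv, hv0⟩ := hv
  obtain ⟨-, b, hb0, hb1, hb⟩ := hE.root e he v hv hv0
  rcases F4.cases hb0 hb1 a with rfl | rfl | rfl | rfl
  · exact absurd rfl h0
  · exact absurd rfl h1
  · exact ⟨e, he, hv, hb⟩
  · refine ⟨e⁻¹, hE.inv e he, by rwa [comm_inv], fun w => ?_⟩
    rw [hE.inv_apply he, hb, hb, form_add_left, form_smul_left, hvv, add_assoc, ← add_smul]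
    congr 2
    linear_combination (b * h w v) * F4.two_eq_zero

lemma lineVector_map {e : V ≃ₗ[ZMod 2] V} (he : e ∈ E) (hv : IsLineVector E v) :
    IsLineVector E (e v) := by
  obtain ⟨f, hf, hv, h0⟩ := hv
  exact ⟨_, hE.conj e he f hf, mem_comm_conj.2 hv, by simpa using h0⟩

/-- The reflection at v with scalar h(u,v)² maps u to u + h(u,v)³v = u + v. -/
lemma lineVector_add (hu : IsLineVector E u) (hv : IsLineVector E v) (h0 : h u v ≠ 0)
    (h1 : h u v ≠ 1) : IsLineVector E (u + v) := by
  have h2 := F4.pow_three h0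
  obtain ⟨e, he, -, hev⟩ := hE.exists_reflection hv (pow_ne_zero 2 h0)
    (fun h3 => h1 (by linear_combination h2 - h u v * h3))
  have := hE.lineVector_map he hu
  rwa [hev, ← pow_succ, h2, one_smul] at this

/-- Any two line vectors have a common neighbour. -/
lemma exists_common_neighbour (hu : IsLineVector E u) (hv : IsLineVector E v) :
    ∃ w, IsLineVector E w ∧ h u w ≠ 0 ∧ h w v ≠ 0 := by
  have huu := hE.lineVector_form hu
  have hu' := hu
  obtain ⟨d, hd, hud, hu0⟩ := hu
  obtain ⟨f, hf, hvf, hv0⟩ := hv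
  refine hE.conn d hd (fun e => ∀ v ∈ comm e, v ≠ 0 → ∃ w, IsLineVector E w ∧ h u w ≠ 0 ∧ h w v ≠ 0)
    ?_ ?_ f hf v hvf hv0
  · intro v hv hv0
    obtain ⟨c, rfl⟩ := hE.exists_smul_eq hd hud hu0 hv
    refine ⟨u, hu', by rw [huu]; exact one_ne_zero, ?_⟩
    rw [form_smul_right, huu, mul_one]
    exact pow_ne_zero _ (left_ne_zero_of_smul hv0)
  · intro e he f hf hQ hn v' hv' hv'0
    obtain ⟨v, hv, hv0⟩ := hE.exists_ne_zero he
    have hvL : IsLineVector E v := ⟨e, he, hv, hv0⟩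
    have hvv' : h v v' ≠ 0 := fun h' => hv'0 (hE.eq_zero_of_not_fixes he hf hn hv' (by
      obtain ⟨-, a, -, -, ha⟩ := hE.root e he v hv hv0
      rw [ha, hE.form_eq_zero_symm h', mul_zero, zero_smul, add_zero]))
    obtain ⟨w, hw, huw, hwv⟩ := hQ v hv hv0
    by_cases huv : h u v = 0
    swap
    · exact ⟨v, hvL, huv, hvv'⟩
    by_cases hwv' : h w v' = 0
    swap
    · exact ⟨w, hw, huw, hwv'⟩
    -- Neither w nor v is a common neighbour of u and v'. A multiple of v is added to w: with
    -- h(w,bv) outside F₂ the sum is a line vector, and it inherits h(u,w) ≠ 0 from w and h(v,v') ≠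
    -- 0 from v.
    obtain ⟨a, ha0, ha1⟩ := F4.exists_generator
    obtain ⟨b, hb0, hb⟩ := exists_smul_form_eq hwv ha0
    refine ⟨w + b • v, hE.lineVector_add hw (hE.lineVector_smul hvL hb0) (hb ▸ ha0) (hb ▸ ha1), ?_, ?_⟩
    · rwa [map_add, form_smul_right, huv, mul_zero, add_zero]
    · rw [form_add_left, hwv', form_smul_left, zero_add]
      exact mul_ne_zero hb0 hvv'

lemma singularVector_form {s : V} (hs : IsSingularVector h E s) : h s s = 0 := by
  obtain ⟨-, l, m, hl, hm, hlm, rfl⟩ := hs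
  rw [map_add, form_add_left, form_add_left, hE.lineVector_form hl, hE.lineVector_form hm,
    hE.herm l m, hlm]
  linear_combination 2 * F4.two_eq_zero

lemma lineVector_add_smul {l m : V} (hl : IsLineVector E l) (hm : IsLineVector E m)
    (hlm : h l m = 1) (c : F4) : IsLineVector E (l + c • (l + m)) := by
  by_cases h0 : c = 0
  · simpa [h0] using hl
  by_cases h1 : c = 1
  · rw [h1, one_smul, ← add_assoc, two_add, zero_add]
    exact hm
  have h2 := F4.quadratic h0 h1
  have h3 : l + c • (l + m) = (c + 1) • l + c • m := by module
  rw [h3]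
  have h4 : h ((c + 1) • l) (c • m) = c := by
    rw [form_smul_left, form_smul_right, hlm]
    linear_combination (c + 2) * h2 + (c + 1) * F4.two_eq_zero
  exact hE.lineVector_add (hE.lineVector_smul hl (F4.add_one_ne h0 h1).1) (hE.lineVector_smul hm h0)
    (h4.symm ▸ h0) (h4.symm ▸ h1)

/-- The representation of a singular vector as a sum of line vectors can be shifted. -/
lemma exists_shift {s w : V} (hs : IsSingularVector h E s) (hsw : h s w ≠ 0) (a : F4) :
    ∃ l m, IsLineVector E l ∧ IsLineVector E m ∧ h l m = 1 ∧ s = l + m ∧ h m w = a := by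
  have hss := hE.singularVector_form hs
  obtain ⟨h0, l, m, hl, hm, hlm, rfl⟩ := hs
  have hml : h m l = 1 := by rw [hE.herm l m, hlm, one_pow]
  -- Adding the same multiple of the isotropic vector l + m to l and to m changes neither their sum
  -- nor h(l,m), and c is solved from h(m + c(l + m), w) = a.
  set c := (a + h m w) * (h (l + m) w)⁻¹ with hc
  refine ⟨l + c • (l + m), m + c • (l + m), hE.lineVector_add_smul hl hm hlm c, ?_, ?_, ?_, ?_⟩
  · rw [add_comm l m]
    exact hE.lineVector_add_smul hm hl hml c
  · have key : ∀ s, h l s = 0 → h s m = 0 → h s s = 0 → h (l + c • s) (m + c • s) = h l m := by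
      intro s h1 h2 h3
      rw [form_add_left, map_add, map_add, form_smul_left, form_smul_left, form_smul_right,
        form_smul_right, h1, h2, h3]
      ring
    rw [key _ _ _ hss, hlm]
    · rw [map_add, hE.lineVector_form hl, hlm, F4.add_self]
    · rw [form_add_left, hE.lineVector_form hm, hlm, F4.add_self]
  · have := two_add (c • (l + m))
    generalize c • (l + m) = y at *
    linear_combination (norm := module) -this
  · rw [form_add_left, form_smul_left, hc, inv_mul_cancel_right₀ hsw]
    linear_combination h m w * F4.two_eq_zero

lemma exists_not_orthogonal {s : V} (hs : s ≠ 0) : ∃ u, IsLineVector E u ∧ h s u ≠ 0 := by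
  by_contra! hcon
  refine hs (hE.nondeg.nondegenerate s ?_)
  refine hE.span_induction (by simp) (fun x y hx hy => by rw [map_add, hx, hy, add_zero]) ?_
  intro e he v hv
  by_cases h0 : v = 0
  · simp [h0]
  · exact hcon v ⟨e, he, hv, h0⟩

/-- Write u + v = (u + bw) + (v + bw) for a line vector w. Both summands are line vectors with
product one as soon as h(u,w) and h(v,w) are nonzero and distinct. -/
lemma singularVector_add_of_orthogonal (hu : IsLineVector E u) (hv : IsLineVector E v)
    (huv : h u v = 0) : IsSingularVector h E (u + v) := by
  have huu := hE.lineVector_form hu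
  have hne : u + v ≠ 0 := fun h' => by
    rw [eq_of_add_eq_zero' h', hE.lineVector_form hv] at huv
    exact one_ne_zero huv
  have hvu := hE.form_eq_zero_symm huv
  have key : ∃ w, IsLineVector E w ∧ h u w ≠ 0 ∧ h v w ≠ 0 ∧ h u w ≠ h v w := by
    obtain ⟨w, hw, huw, hwv⟩ := hE.exists_common_neighbour hu hv
    have hvw : h v w ≠ 0 := fun h' => hwv (hE.form_eq_zero_symm h')
    by_cases heq : h u w = h v w
    swap
    · exact ⟨w, hw, huw, hvw, heq⟩
    -- When the two products coincide, adding a multiple of u to w scales h(u,w) by 1 + a and leaves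
    -- h(v,w) alone.
    obtain ⟨a, ha0, ha1⟩ := F4.exists_generator
    have hwu : h w u ≠ 0 := fun h' => huw (hE.form_eq_zero_symm h')
    obtain ⟨b, hb0, hb⟩ := exists_smul_form_eq hwu ha0
    have h1 : b ^ 2 * h u w ^ 2 = a := by
      rw [← hb, form_smul_right, hE.herm u w]
    have h2 : h u (w + b • u) = (1 + a) * h u w := by
      rw [map_add, form_smul_right, huu]
      linear_combination h u w * h1 - b ^ 2 * (F4.pow_three huw)
    have h3 : h v (w + b • u) = h v w := by
      rw [map_add, form_smul_right, hvu, mul_zero, add_zero]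
    refine ⟨w + b • u, hE.lineVector_add hw (hE.lineVector_smul hu hb0) (hb ▸ ha0) (hb ▸ ha1),
      ?_, by rwa [h3], ?_⟩
    · rw [h2, add_comm]
      exact mul_ne_zero (F4.add_one_ne ha0 ha1).1 huw
    · rw [h2, h3, heq]
      intro h4
      exact mul_ne_zero ha0 hvw (by linear_combination h4)
  obtain ⟨w, hw, huw, hvw, hne'⟩ := key
  set r := h u w * (h v w)⁻¹ with hr
  have hr0 : r ≠ 0 := mul_ne_zero huw (inv_ne_zero hvw)
  have hr1 : r ≠ 1 := fun h' => hne' (by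
    rw [hr, ← div_eq_mul_inv, div_eq_one_iff_eq hvw] at h'
    exact h')
  have hur : h u w = r * h v w := by rw [hr, inv_mul_cancel_right₀ hvw]
  -- With h(v,bw) = r the other product is h(u,bw) = r². Neither lies in F₂, and in the product of
  -- the summands r² and the conjugate of r cancel, leaving the norm one of bw.
  obtain ⟨b, hb0, hb⟩ := exists_smul_form_eq hvw hr0
  have hub : h u (b • w) = r ^ 2 := by
    rw [form_smul_right, hur]
    rw [form_smul_right] at hb
    linear_combination r * hb
  have hbL := hE.lineVector_smul hw hb0
  refine ⟨hne, u + b • w, v + b • w, hE.lineVector_add hu hbL ?_ ?_,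
    hE.lineVector_add hv hbL (hb ▸ hr0) (hb ▸ hr1), ?_, ?_⟩
  · rw [hub]
    exact pow_ne_zero _ hr0
  · rw [hub, F4.quadratic hr0 hr1]
    exact (F4.add_one_ne hr0 hr1).2
  · rw [form_add_left, map_add, huv, hub, map_add, hE.lineVector_form hbL, hE.herm v (b • w), hb]
    linear_combination r ^ 2 * F4.two_eq_zero
  · have := two_add (b • w)
    generalize b • w = y at *
    linear_combination (norm := module) -this

/-- Shifting the decomposition s = l + m so that h(m,u) = a lies outside F₂ makes m + u a line
vector, and then h(l, m + u) = a too. -/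
lemma lineVector_singular_add_of_form_eq_one {s : V} (hs : IsSingularVector h E s)
    (hu : IsLineVector E u) (hsu : h s u = 1) : IsLineVector E (s + u) := by
  obtain ⟨a, ha0, ha1⟩ := F4.exists_generator
  obtain ⟨l, m, hl, hm, hlm, rfl, hmu⟩ := hE.exists_shift hs (hsu.symm ▸ one_ne_zero) a
  rw [add_assoc]
  have h1 : h l (m + u) = a := by
    rw [form_add_left] at hsu
    rw [map_add, hlm]
    linear_combination hsu - hmu + (1 - a) * F4.two_eq_zero
  exact hE.lineVector_add hl (hE.lineVector_add hm hu (hmu ▸ ha0) (hmu ▸ ha1))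
    (h1 ▸ ha0) (h1 ▸ ha1)

/-- Choose a line vector u with h(s,u) = 1 and h(v,u) outside F₂. Then v + s = (v + u) + (s + u) is
a sum of line vectors whose product is again h(v,u). -/
lemma lineVector_add_singular {s : V} (hv : IsLineVector E v) (hs : IsSingularVector h E s)
    (hvs : h v s = 0) : IsLineVector E (v + s) := by
  have hsv := hE.form_eq_zero_symm hvs
  obtain ⟨a, ha0, ha1⟩ := F4.exists_generator
  have key₁ : ∃ u, IsLineVector E u ∧ h s u ≠ 0 ∧ h v u ≠ 0 := by
    obtain ⟨u, hu, hsu⟩ := hE.exists_not_orthogonal hs.1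
    obtain ⟨w, hw, huw, hwv⟩ := hE.exists_common_neighbour hu hv
    have hvw : h v w ≠ 0 := fun h' => hwv (hE.form_eq_zero_symm h')
    have hwu : h w u ≠ 0 := fun h' => huw (hE.form_eq_zero_symm h')
    by_cases hvu : h v u = 0
    swap
    · exact ⟨u, hu, hsu, hvu⟩
    by_cases hsw : h s w = 0
    swap
    · exact ⟨w, hw, hsw, hvw⟩
    obtain ⟨b, hb0, hb⟩ := exists_smul_form_eq hwu ha0
    refine ⟨w + b • u, hE.lineVector_add hw (hE.lineVector_smul hu hb0) (hb ▸ ha0) (hb ▸ ha1),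
      ?_, ?_⟩
    · rw [map_add, hsw, zero_add, form_smul_right]
      exact mul_ne_zero (pow_ne_zero _ hb0) hsu
    · rwa [map_add, form_smul_right, hvu, mul_zero, add_zero]
  have key₂ : ∃ u, IsLineVector E u ∧ h s u = 1 ∧ h v u ≠ 0 ∧ h v u ≠ 1 := by
    obtain ⟨u₀, hu₀, hsu₀, hvu₀⟩ := key₁
    obtain ⟨b, hb0, hb⟩ := exists_smul_form_eq hsu₀ one_ne_zero
    have hu := hE.lineVector_smul hu₀ hb0
    have hvu : h v (b • u₀) ≠ 0 := by
      rw [form_smul_right]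
      exact mul_ne_zero (pow_ne_zero _ hb0) hvu₀
    by_cases h1 : h v (b • u₀) = 1
    swap
    · exact ⟨_, hu, hb, hvu, h1⟩
    have hq := F4.quadratic ha0 ha1
    have huv : h (b • u₀) (a • v) = a + 1 := by
      rw [form_smul_right, hE.herm v (b • u₀), h1, hq]; ring
    obtain ⟨h2, h3⟩ := F4.add_one_ne ha0 ha1
    have h4 : h v (b • u₀ + a • v) = a := by
      rw [map_add, form_smul_right h v v, h1, hE.lineVector_form hv, hq]
      linear_combination F4.two_eq_zero
    refine ⟨b • u₀ + a • v, hE.lineVector_add hu (hE.lineVector_smul hv ha0) (huv ▸ h2) (huv ▸ h3),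
      ?_, h4.symm ▸ ha0, h4.symm ▸ ha1⟩
    rw [map_add, form_smul_right h s v, hsv, mul_zero, add_zero, hb]
  obtain ⟨u, hu, hsu, hvu0, hvu1⟩ := key₂
  have h1 := hE.lineVector_singular_add_of_form_eq_one hs hu hsu
  have h2 := hE.lineVector_add hv hu hvu0 hvu1
  have h3 : h (v + u) (s + u) = h v u := by
    rw [form_add_left, map_add, map_add, hvs, hE.lineVector_form hu, hE.herm s u, hsu]
    linear_combination F4.two_eq_zero
  have h4 := hE.lineVector_add h2 h1 (h3.symm ▸ hvu0) (h3.symm ▸ hvu1)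
  have h5 : v + u + (s + u) = v + s := by
    linear_combination (norm := module) two_add u
  rwa [h5] at h4

lemma lineVector_add_cases (hu : IsLineVector E u) (hv : IsLineVector E v) :
    u + v = 0 ∨ IsLineVector E (u + v) ∨ IsSingularVector h E (u + v) := by
  by_cases h0 : h u v = 0
  · exact Or.inr (Or.inr (hE.singularVector_add_of_orthogonal hu hv h0))
  by_cases h1 : h u v = 1
  · by_cases h2 : u + v = 0
    · exact Or.inl h2
    · exact Or.inr (Or.inr ⟨h2, u, v, hu, hv, h1, rfl⟩)
  · exact Or.inr (Or.inl (hE.lineVector_add hu hv h0 h1))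

/-- Every nonzero vector lies on a line or on a singular line. -/
lemma vector_cases (x : V) : x = 0 ∨ IsLineVector E x ∨ IsSingularVector h E x := by
  -- Since line vectors span V, it suffices that the three types together are closed under adding a
  -- line vector.
  have key : ∀ x y, (y = 0 ∨ IsLineVector E y ∨ IsSingularVector h E y) →
      (y + x = 0 ∨ IsLineVector E (y + x) ∨ IsSingularVector h E (y + x)) := by
    refine hE.span_induction (by simp) (fun x x' hx hx' y hy => ?_) (fun e he v hv y hy => ?_)
    · rw [← add_assoc]
      exact hx' _ (hx _ hy)
    · by_cases h0 : v = 0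
      · simpa [h0] using hy
      have hvL : IsLineVector E v := ⟨e, he, hv, h0⟩
      rcases hy with rfl | hy | hy
      · rw [zero_add]
        exact Or.inr (Or.inl hvL)
      · exact hE.lineVector_add_cases hy hvL
      · by_cases hyv : h y v = 0
        · rw [add_comm]
          exact Or.inr (Or.inl (hE.lineVector_add_singular hvL hy (hE.form_eq_zero_symm hyv)))
        · obtain ⟨a, ha0, ha1⟩ := F4.exists_generator
          obtain ⟨l, m, hl, hm, hlm, rfl, hmv⟩ := hE.exists_shift hy hyv a
          rw [add_assoc]
          exact hE.lineVector_add_cases hl (hE.lineVector_add hm hvL (hmv ▸ ha0) (hmv ▸ ha1))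
  have := key x 0 (Or.inl rfl)
  rwa [zero_add] at this

lemma lineVector_iff : IsLineVector E v ↔ h v v = 1 := by
  refine ⟨hE.lineVector_form, fun hv => ?_⟩
  rcases hE.vector_cases v with rfl | h1 | h1
  · simp at hv
  · exact h1
  · rw [hE.singularVector_form h1] at hv
    exact absurd hv zero_ne_one

lemma singularVector_iff : IsSingularVector h E v ↔ v ≠ 0 ∧ h v v = 0 := by
  refine ⟨fun hv => ⟨hv.1, hE.singularVector_form hv⟩, fun ⟨h0, hv⟩ => ?_⟩
  rcases hE.vector_cases v with h1 | h1 | h1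
  · exact absurd h1 h0
  · rw [hE.lineVector_form h1] at hv
    exact absurd hv one_ne_zero
  · exact h1

end IsUnitaryRootSet
end Classification
-- The group is finitary unitary; its reflection classes
section Group

variable {V : Type*} [AddCommGroup V] [Module (ZMod 2) V] [Module F4 V]

namespace IsUnitaryRootSet

variable {h : V →ₗ[F4] V →ₛₗ[frobenius F4 2] F4} {E : Set (V ≃ₗ[ZMod 2] V)}
  (hE : IsUnitaryRootSet h E) {u v : V}

include hE

lemma form_root {e : V ≃ₗ[ZMod 2] V} (he : e ∈ E) (x y : V) : h (e x) (e y) = h x y := by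
  obtain ⟨v, hv, h0⟩ := hE.exists_ne_zero he
  obtain ⟨hvv, a, ha0, ha1, ha⟩ := hE.root e he v hv h0
  have h1 := F4.quadratic ha0 ha1
  have h2 := F4.pow_three ha0
  rw [ha, ha, form_add_left, map_add, map_add, form_smul_left, form_smul_left, form_smul_right,
    form_smul_right, hvv, mul_pow, hE.herm y v]
  linear_combination (h x v * h y v ^ 2) * (h1 + h2 + (a + 1) * F4.two_eq_zero)

lemma exists_linearEquiv {g : V ≃ₗ[ZMod 2] V} (hg : g ∈ Subgroup.closure E) :
    ∃ γ ∈ finitaryUnitary h, ∀ x, γ x = g x := by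
  refine Subgroup.closure_induction (p := fun g _ => ∃ γ ∈ finitaryUnitary h, ∀ x, γ x = g x)
    ?_ ?_ ?_ ?_ hg
  · intro e he
    refine ⟨{ e.toAddEquiv with map_smul' := fun a x => hE.linear e he a x }, ⟨?_, ?_⟩, fun x => rfl⟩
    · exact hE.form_root he
    · obtain ⟨v, hv, h0⟩ := hE.exists_ne_zero he
      obtain ⟨-, a, -, -, ha⟩ := hE.root e he v hv h0
      refine Submodule.finiteDimensional_of_le (S₂ := Submodule.span F4 {v}) ?_
      rintro _ ⟨x, rfl⟩
      rw [Submodule.mem_span_singleton]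
      refine ⟨a * h x v, ?_⟩
      change _ = e x - x
      rw [ha, add_sub_cancel_left]
  · exact ⟨1, one_mem _, fun x => rfl⟩
  · rintro x y - - ⟨γ, hγ, h1⟩ ⟨δ, hδ, h2⟩
    refine ⟨γ * δ, mul_mem hγ hδ, fun z => ?_⟩
    rw [LinearEquiv.mul_apply, LinearEquiv.mul_apply, h2, h1]
  · rintro x - ⟨γ, hγ, h1⟩
    refine ⟨γ⁻¹, inv_mem hγ, fun z => ?_⟩
    apply γ.injective
    rw [h1 (x⁻¹ z), ← LinearEquiv.mul_apply, ← LinearEquiv.mul_apply]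
    simp

lemma closure_smul {g : V ≃ₗ[ZMod 2] V} (hg : g ∈ Subgroup.closure E) (a : F4) (x : V) :
    g (a • x) = a • g x := by
  obtain ⟨γ, -, hγ⟩ := hE.exists_linearEquiv hg
  rw [← hγ, ← hγ, map_smul]

lemma closure_form {g : V ≃ₗ[ZMod 2] V} (hg : g ∈ Subgroup.closure E) (x y : V) :
    h (g x) (g y) = h x y := by
  obtain ⟨γ, hγ, hγ'⟩ := hE.exists_linearEquiv hg
  rw [← hγ', ← hγ', hγ.1]

/-- Take reflections r at l and s at m with scalars a and a². They multiply the plane ⟨l,m⟩ modulo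
its radical ⟨l + m⟩ by a² and a, so rs is unipotent there; its square is the transvection. -/
lemma exists_closure_transvection {u : V} (hu : IsSingularVector h E u) :
    ∃ τ ∈ Subgroup.closure E, ∀ w, τ w = w + (h w u) • u := by
  obtain ⟨-, l, m, hl, hm, hlm, rfl⟩ := hu
  have hml : h m l = 1 := by rw [hE.herm l m, hlm, one_pow]
  obtain ⟨a, ha0, ha1⟩ := F4.exists_generator
  have hq := F4.quadratic ha0 ha1
  have ha3 := F4.pow_three ha0
  obtain ⟨r, hr, -, hrl⟩ := hE.exists_reflection hl ha0 ha1
  obtain ⟨s, hs, -, hsm⟩ := hE.exists_reflection hm (a := a ^ 2) (pow_ne_zero 2 ha0) (by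
    rw [hq]; exact (F4.add_one_ne ha0 ha1).2)
  have hmem : r * s ∈ Subgroup.closure E :=
    mul_mem (Subgroup.subset_closure hr) (Subgroup.subset_closure hs)
  have hrs : ∀ w, (r * s) w = w + ((a ^ 2 * h w m) • m + (h w m + a * h w l) • l) := by
    intro w
    rw [LinearEquiv.mul_apply, hsm, hrl, form_add_left, form_smul_left, hml, add_assoc]
    congr 3
    linear_combination h w m * ha3
  refine ⟨(r * s) * (r * s), mul_mem hmem hmem, fun w => ?_⟩
  rw [LinearEquiv.mul_apply, hrs, hrs, form_add_left, form_add_left, form_add_left, form_add_left,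
    form_smul_left, form_smul_left, form_smul_left, form_smul_left, hE.lineVector_form hl,
    hE.lineVector_form hm, hlm, hml, map_add, add_assoc]
  generalize h w l = A
  generalize h w m = B
  have h1 : a ^ 2 * B + a ^ 2 * (B + (a ^ 2 * B * 1 + (B + a * A) * 1)) = A + B := by
    linear_combination (A + a * B + 2 * B) * ha3 + (3 * B) * hq + (2 * a * B - a ^ 3 * B + 2 * B) * F4.two_eq_zero
  have h2 : (B + a * A) + (B + (a ^ 2 * B * 1 + (B + a * A) * 1) +
      a * (A + (a ^ 2 * B * 1 + (B + a * A) * 1))) = A + B := by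
    linear_combination B * ha3 + (A + B) * hq + (2 * a * A + a * B + 2 * B) * F4.two_eq_zero
  rw [← h1]
  conv_rhs => rw [smul_add, h1]
  conv_rhs => enter [2, 1]; rw [← h2]
  conv_rhs => enter [2, 2]; rw [← h1]
  module

/-- The displayed map sends every x with h(x,u) = c to x + u. The norm condition makes it a
transvection for c = 1 and a reflection at a vector of norm one otherwise. -/
lemma exists_closure_apply {u : V} {c : F4} (hc : c ≠ 0) (hu : u ≠ 0) (huu : h u u = c + c ^ 2) :
    ∃ τ ∈ Subgroup.closure E, ∀ w, τ w = w + (c⁻¹ * h w u) • u := by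
  by_cases h1 : c = 1
  · subst h1
    rw [one_pow, F4.add_self] at huu
    simpa using hE.exists_closure_transvection (hE.singularVector_iff.2 ⟨hu, huu⟩)
  · rw [F4.quadratic hc h1, ← add_assoc, F4.add_self, zero_add] at huu
    obtain ⟨e, he, -, h2⟩ := hE.exists_reflection (hE.lineVector_iff.2 huu) (inv_ne_zero hc)
      (inv_ne_one.2 h1)
    exact ⟨e, Subgroup.subset_closure he, h2⟩

/-- If the sesquilinear form h(x, (γ - 1)y) vanished on the diagonal, comparing x + y with ax + y
would kill it entirely, because a ≠ a². -/
lemma exists_form_ne_zero {γ : V ≃ₗ[F4] V} (hγ : γ ≠ 1) : ∃ x, h x (γ x - x) ≠ 0 := by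
  by_contra! hcon
  apply hγ
  obtain ⟨a, ha0, ha1⟩ := F4.exists_generator
  have hq := F4.quadratic ha0 ha1
  have key : ∀ x y, h x (γ y - y) = 0 := fun x y => by
    have h1 := hcon (x + y)
    have h2 := hcon (a • x + y)
    have h3 : γ (x + y) - (x + y) = (γ x - x) + (γ y - y) := by rw [map_add]; abel
    have h4 : γ (a • x + y) - (a • x + y) = a • (γ x - x) + (γ y - y) := by
      rw [map_add, map_smul]; module
    rw [h3, form_add_left, map_add, map_add, hcon, hcon] at h1
    rw [h4, form_add_left, form_smul_left, map_add, map_add, form_smul_right, hcon,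
      form_smul_right, hcon] at h2
    linear_combination a ^ 2 * h1 - h2 - h x (γ y - y) * hq
  ext y
  refine sub_eq_zero.1 (hE.nondeg.nondegenerate _ fun x => ?_)
  rw [hE.herm x]
  change h x (γ y - y) ^ 2 = 0
  rw [key]
  simp

lemma fixed_iff_orthogonal {γ : V ≃ₗ[F4] V} (hγ : ∀ x y, h (γ x) (γ y) = h x y) (w : V) :
    γ w = w ↔ ∀ r ∈ LinearMap.range ((γ : V →ₗ[F4] V) - LinearMap.id), h r w = 0 := by
  constructor
  · rintro hw _ ⟨y, rfl⟩
    change h (γ y - y) w = 0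
    rw [map_sub, LinearMap.sub_apply]
    conv_lhs => enter [1, 2]; rw [← hw]
    rw [hγ, sub_self]
  · intro hw
    refine sub_eq_zero.1 (hE.nondeg.nondegenerate _ fun x => ?_)
    obtain ⟨y, rfl⟩ := γ.surjective x
    have h1 : h (γ y - y) w = 0 := hw _ ⟨y, rfl⟩
    rw [hE.herm (γ y), map_sub, hγ]
    rw [map_sub, LinearMap.sub_apply] at h1
    rw [show h y w - h (γ y) w = 0 by linear_combination - h1]
    simp

/-- Finitary isometries are products of roots. -/
lemma mem_closure_of_finitary : ∀ (n : ℕ) (γ : V ≃ₗ[F4] V), γ ∈ finitaryUnitary h →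
    Module.finrank F4 (LinearMap.range ((γ : V →ₗ[F4] V) - LinearMap.id)) = n →
    ∀ g : V ≃ₗ[ZMod 2] V, (∀ x, g x = γ x) → g ∈ Subgroup.closure E := by
  intro n
  induction n using Nat.strong_induction_on with
  | _ n ih =>
  intro γ hγ hn g hg
  by_cases h1 : γ = 1
  · have : g = 1 := by
      ext x
      rw [hg, h1]
      rfl
    rw [this]
    exact one_mem _
  obtain ⟨x, hx⟩ := hE.exists_form_ne_zero h1
  have hfin := hγ.2
  set u := γ x - x with hu
  have hu0 : u ≠ 0 := fun h0 => hx (by rw [h0, map_zero])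
  have huu : h u u = h x u + h x u ^ 2 := by
    rw [← hE.herm x u, hu]
    simp only [map_sub, LinearMap.sub_apply, hγ.1]
    linear_combination (2 * h x x - h x (γ x) - h (γ x) x) * F4.two_eq_zero
  -- Cartan–Dieudonné step: τ agrees with γ at x and τ - 1 has image in ⟨u⟩ ≤ [V,γ], so removing τ
  -- keeps the commutator space inside [V,γ] and gains the fixed vector x.
  obtain ⟨τ, hτ, hτu⟩ := hE.exists_closure_apply hx hu0 huu
  obtain ⟨t, ht, htτ⟩ := hE.exists_linearEquiv hτ
  have hτx : τ x = γ x := by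
    rw [hτu, inv_mul_cancel₀ hx, one_smul, hu]
    abel
  have hδ : t⁻¹ * γ ∈ finitaryUnitary h := mul_mem (inv_mem ht) hγ
  have htt : ∀ z, t (t⁻¹ z) = z := fun z => by rw [← LinearEquiv.mul_apply]; simp
  have hδx : (t⁻¹ * γ) x = x := by
    apply t.injective
    rw [LinearEquiv.mul_apply, htt, htτ, hτx]
  have hle : LinearMap.range (((t⁻¹ * γ : V ≃ₗ[F4] V) : V →ₗ[F4] V) - LinearMap.id) ≤
      LinearMap.range ((γ : V →ₗ[F4] V) - LinearMap.id) := by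
    rintro _ ⟨y, rfl⟩
    change t⁻¹ (γ y) - y ∈ _
    have h2 : t⁻¹ (γ y) = γ y - ((h x u)⁻¹ * h (t⁻¹ (γ y)) u) • u := by
      have h3 := htt (γ y)
      rw [htτ, hτu] at h3
      conv_rhs => enter [1]; rw [← h3]
      rw [add_sub_cancel_right]
    have h4 : t⁻¹ (γ y) - y = (γ y - y) - ((h x u)⁻¹ * h (t⁻¹ (γ y)) u) • u := by
      conv_lhs => rw [h2]
      abel
    rw [h4]
    exact Submodule.sub_mem _ ⟨y, rfl⟩ (Submodule.smul_mem _ _ ⟨x, rfl⟩)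
  have hlt : LinearMap.range (((t⁻¹ * γ : V ≃ₗ[F4] V) : V →ₗ[F4] V) - LinearMap.id) <
      LinearMap.range ((γ : V →ₗ[F4] V) - LinearMap.id) := by
    -- Fixed vectors of an isometry are those orthogonal to its commutator space. Equality of the
    -- two spaces would make γ fix x as well, that is, u = 0.
    refine lt_of_le_of_ne hle fun heq => hu0 ?_
    have h2 := (hE.fixed_iff_orthogonal hδ.1 x).1 hδx
    rw [heq] at h2
    rw [hu, sub_eq_zero]
    exact (hE.fixed_iff_orthogonal hγ.1 x).2 h2
  have h5 := ih _ (hn ▸ Submodule.finrank_lt_finrank_of_lt hlt) _ hδ rfl (τ⁻¹ * g) fun y => by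
    apply t.injective
    rw [LinearEquiv.mul_apply, LinearEquiv.mul_apply, htt, htτ, hg, ← LinearEquiv.mul_apply]
    simp
  have h6 := mul_mem hτ h5
  rwa [mul_inv_cancel_left] at h6

lemma mem_closure_iff {g : V ≃ₗ[ZMod 2] V} :
    g ∈ Subgroup.closure E ↔ ∃ γ ∈ finitaryUnitary h, ∀ x, γ x = g x :=
  ⟨hE.exists_linearEquiv, fun ⟨γ, hγ, hg⟩ =>
    hE.mem_closure_of_finitary _ γ hγ rfl g fun x => (hg x).symm⟩

lemma exists_mulEquiv {G : Subgroup (V ≃ₗ[ZMod 2] V)} (hG : Subgroup.closure E = G) :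
    ∃ e : G ≃* finitaryUnitary h, ∀ (g : G) (x : V), (e g).1 x = g.1 x := by
  subst hG
  have hex : ∀ g : Subgroup.closure E, ∃ γ : finitaryUnitary h, ∀ x, γ.1 x = g.1 x := fun g => by
    obtain ⟨γ, hγ, h1⟩ := hE.exists_linearEquiv g.2
    exact ⟨⟨γ, hγ⟩, h1⟩
  choose F hF using hex
  have hbij : Function.Bijective F := by
    refine ⟨fun a b hab => ?_, fun γ => ?_⟩
    · ext x
      rw [← hF, ← hF, hab]
    · let g : V ≃ₗ[ZMod 2] V :=
        { γ.1.toAddEquiv with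
          map_smul' := fun c x => ZMod.map_smul (γ.1.toAddEquiv.toAddMonoidHom) c x }
      have hg : g ∈ Subgroup.closure E := hE.mem_closure_iff.2 ⟨γ.1, γ.2, fun x => rfl⟩
      refine ⟨⟨g, hg⟩, ?_⟩
      ext x
      rw [hF]
      rfl
  refine ⟨MulEquiv.mk (Equiv.ofBijective F hbij) fun a b => ?_, fun g x => hF g x⟩
  ext x
  change (F (a * b)).1 x = (F a * F b).1 x
  rw [hF, Subgroup.coe_mul, Subgroup.coe_mul, LinearEquiv.mul_apply, LinearEquiv.mul_apply, hF, hF]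

lemma exists_closure_smul (hv : h v v = 1) {c : F4} (hc : c ≠ 0) :
    ∃ g ∈ Subgroup.closure E, g v = c • v := by
  by_cases h1 : c = 1
  · exact ⟨1, one_mem _, by rw [h1, one_smul]; rfl⟩
  obtain ⟨h2, h3⟩ := F4.add_one_ne hc h1
  obtain ⟨e, he, -, hev⟩ := hE.exists_reflection (hE.lineVector_iff.2 hv) h2 h3
  refine ⟨e, Subgroup.subset_closure he, ?_⟩
  rw [hev, hv, mul_one]
  linear_combination (norm := module) two_add v

/-- The reflection at v with scalar a sends u to u + av, and the one at u with scalar a² sends av to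
av + u as well. Their quotient maps u to av, and a further reflection at v removes the scalar a. -/
lemma exists_closure_eq_of_form_eq_one (hu : h u u = 1) (hv : h v v = 1) (huv : h u v = 1) :
    ∃ g ∈ Subgroup.closure E, g u = v := by
  obtain ⟨a, ha0, ha1⟩ := F4.exists_generator
  have ha3 := F4.pow_three ha0
  have hvu : h v u = 1 := by rw [hE.herm u v, huv, one_pow]
  obtain ⟨r, hr, -, hrv⟩ := hE.exists_reflection (hE.lineVector_iff.2 hv) ha0 ha1
  obtain ⟨s, hs, -, hsu⟩ := hE.exists_reflection (hE.lineVector_iff.2 hu) (a := a ^ 2)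
    (pow_ne_zero 2 ha0) (by rw [F4.quadratic ha0 ha1]; exact (F4.add_one_ne ha0 ha1).2)
  obtain ⟨k, hk, hkv⟩ := hE.exists_closure_smul hv (inv_ne_zero ha0)
  refine ⟨k * (s⁻¹ * r), mul_mem hk (mul_mem (inv_mem (Subgroup.subset_closure hs))
    (Subgroup.subset_closure hr)), ?_⟩
  have h1 : (s⁻¹ * r) u = a • v := by
    apply s.injective
    rw [LinearEquiv.mul_apply, ← LinearEquiv.mul_apply, mul_inv_cancel, hE.linear s hs, hsu, hvu,
      mul_one, smul_add, smul_smul, ← pow_succ', ha3, one_smul]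
    change r u = _
    rw [hrv, huv, mul_one, add_comm]
  rw [LinearEquiv.mul_apply, h1, hE.closure_smul hk, hkv, smul_smul, mul_inv_cancel₀ ha0, one_smul]

/-- The group is transitive on the vectors of norm one. -/
lemma exists_closure_eq (hu : h u u = 1) (hv : h v v = 1) :
    ∃ g ∈ Subgroup.closure E, g u = v := by
  have key : ∀ u v, h u u = 1 → h v v = 1 → h u v ≠ 0 → ∃ g ∈ Subgroup.closure E, g u = v := by
    intro u v hu hv huv
    obtain ⟨b, hb0, hb⟩ := exists_smul_form_eq huv one_ne_zero
    have hbv : h (b • v) (b • v) = 1 := by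
      rw [form_smul_left, form_smul_right, hv, mul_one, ← pow_succ', F4.pow_three hb0]
    obtain ⟨g, hg, hgu⟩ := hE.exists_closure_eq_of_form_eq_one hu hbv hb
    obtain ⟨k, hk, hkv⟩ := hE.exists_closure_smul hv (inv_ne_zero hb0)
    refine ⟨k * g, mul_mem hk hg, ?_⟩
    rw [LinearEquiv.mul_apply, hgu, hE.closure_smul hk, hkv, smul_smul, mul_inv_cancel₀ hb0,
      one_smul]
  obtain ⟨w, hw, huw, hwv⟩ := hE.exists_common_neighbour (hE.lineVector_iff.2 hu)
    (hE.lineVector_iff.2 hv)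
  obtain ⟨g, hg, hgu⟩ := key u w hu (hE.lineVector_form hw) huw
  obtain ⟨k, hk, hkw⟩ := key w v (hE.lineVector_form hw) hv hwv
  exact ⟨k * g, mul_mem hk hg, by rw [LinearEquiv.mul_apply, hgu, hkw]⟩

lemma conj_reflection {g r : V ≃ₗ[ZMod 2] V} (hg : g ∈ Subgroup.closure E) {a : F4}
    (hr : ∀ w, r w = w + (a * h w v) • v) (w : V) :
    (g * r * g⁻¹) w = w + (a * h w (g v)) • g v := by
  obtain ⟨y, rfl⟩ := g.surjective w
  rw [conj_apply, hr, map_add, hE.closure_smul hg, hE.closure_form hg]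

lemma unitaryReflections_subset {a : F4} (h0 : a ≠ 0) (h1 : a ≠ 1) :
    unitaryReflections h a ⊆ E := by
  rintro g ⟨v, hv, hg⟩
  obtain ⟨e, he, -, hev⟩ := hE.exists_reflection (hE.lineVector_iff.2 hv) h0 h1
  have : g = e := by
    ext w
    rw [hg, hev]
  rwa [this]

lemma exists_conj_of_unitaryReflections {a : F4} {r s : V ≃ₗ[ZMod 2] V}
    (hr : r ∈ unitaryReflections h a) (hs : s ∈ unitaryReflections h a) :
    ∃ g ∈ Subgroup.closure E, s = g * r * g⁻¹ := by
  obtain ⟨v, hv, hr⟩ := hr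
  obtain ⟨u, hu, hs⟩ := hs
  obtain ⟨g, hg, hgv⟩ := hE.exists_closure_eq hv hu
  refine ⟨g, hg, ?_⟩
  ext w
  rw [hE.conj_reflection hg hr, hs, hgv]

lemma exists_norm_one : ∃ v, h v v = 1 := by
  obtain ⟨e, he⟩ := hE.nonempty
  obtain ⟨v, hv, h0⟩ := hE.exists_ne_zero he
  exact ⟨v, hE.lineVector_form ⟨e, he, hv, h0⟩⟩

lemma unitaryReflections_eq_conj {a : F4} (h0 : a ≠ 0) (h1 : a ≠ 1) :
    ∃ r ∈ Subgroup.closure E,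
      unitaryReflections h a = {s | ∃ g ∈ Subgroup.closure E, s = g * r * g⁻¹} := by
  obtain ⟨v, hv⟩ := hE.exists_norm_one
  obtain ⟨e, he, -, hev⟩ := hE.exists_reflection (hE.lineVector_iff.2 hv) h0 h1
  refine ⟨e, Subgroup.subset_closure he, ?_⟩
  ext s
  constructor
  · exact hE.exists_conj_of_unitaryReflections ⟨v, hv, hev⟩
  · rintro ⟨g, hg, rfl⟩
    exact ⟨g v, by rw [hE.closure_form hg, hv], hE.conj_reflection hg hev⟩

lemma setOf_isReflection : {g | g ∈ Subgroup.closure E ∧ IsReflection g} =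
    ⋃ a ∈ {a : F4 | a ≠ 0 ∧ a ≠ 1}, unitaryReflections h a := by
  ext g
  simp only [Set.mem_ofPred_eq, Set.mem_iUnion, exists_prop]
  constructor
  · rintro ⟨hg, v, φ, hφ0, hφ1, hgφ⟩
    have h0 : v ≠ 0 := by rintro rfl; exact hφ0 (map_zero φ)
    have hgv : g v = (1 + φ v) • v := by
      rw [hgφ]
      linear_combination (norm := module) -two_add (φ v • v)
    -- Comparing h(gw,gv) with h(w,v) shows that φ(·)h(v,v) and h(·,v) are proportional. So v cannot
    -- be isotropic, as it would lie in the radical, and φ = φ(v) h(·,v).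
    have key : ∀ w, φ w * h v v = φ v * h w v := fun w => by
      have h1 := hE.closure_form hg w v
      have h2 := F4.quadratic hφ0 hφ1
      rw [hgv, hgφ, map_sub, LinearMap.sub_apply, form_smul_right, form_smul_right,
        form_smul_left] at h1
      have h3 := F4.pow_three hφ0
      have h4 : (1 + φ v) ^ 2 = φ v := by
        linear_combination h2 + (φ v + 1) * F4.two_eq_zero
      rw [h4] at h1
      linear_combination (-φ v ^ 2) * h1 - (φ w * h v v - h w v) * h3 - h w v * h2 -
        φ v * h w v * F4.two_eq_zero
    rcases hE.form_self v with hvv | hvv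
    · refine absurd (hE.nondeg.nondegenerate v fun w => ?_) h0
      have h1 := key w
      rw [hvv, mul_zero, eq_comm, mul_eq_zero] at h1
      exact hE.form_eq_zero_symm (h1.resolve_left hφ0)
    · refine ⟨φ v, ⟨hφ0, hφ1⟩, v, hvv, fun w => ?_⟩
      rw [← key, hvv, mul_one, hgφ, ZModModule.sub_eq_add]
  · rintro ⟨a, ⟨h0, h1⟩, hg⟩
    refine ⟨Subgroup.subset_closure (hE.unitaryReflections_subset h0 h1 hg), ?_⟩
    obtain ⟨v, hv, hg⟩ := hg
    have h2 : ∀ w, (a • h.flip v) w = a * h w v := fun w => rfl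
    refine ⟨v, a • h.flip v, ?_, ?_, fun w => ?_⟩
    · rwa [h2, hv, mul_one]
    · rwa [h2, hv, mul_one]
    · rw [h2, hg, ZModModule.sub_eq_add]

lemma eq_iUnion_unitaryReflections {D : Set (V ≃ₗ[ZMod 2] V)} (hD : D ⊆ E) (hne : D.Nonempty)
    (hnormal : ∀ g ∈ Subgroup.closure E, ∀ d ∈ D, g * d * g⁻¹ ∈ D) :
    ∃ A : Set F4, A.Nonempty ∧ A ⊆ {a | a ≠ 0 ∧ a ≠ 1} ∧
      D = ⋃ a ∈ A, unitaryReflections h a := by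
  have key : ∀ d ∈ D, ∃ a : F4, a ≠ 0 ∧ a ≠ 1 ∧ d ∈ unitaryReflections h a := fun d hd => by
    obtain ⟨v, hv, h0⟩ := hE.exists_ne_zero (hD hd)
    obtain ⟨hvv, a, ha0, ha1, ha⟩ := hE.root d (hD hd) v hv h0
    exact ⟨a, ha0, ha1, v, hvv, ha⟩
  refine ⟨{a | a ≠ 0 ∧ a ≠ 1 ∧ ∃ d ∈ D, d ∈ unitaryReflections h a}, ?_,
    fun a ha => ⟨ha.1, ha.2.1⟩, ?_⟩
  · obtain ⟨d, hd⟩ := hne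
    obtain ⟨a, h0, h1, h2⟩ := key d hd
    exact ⟨a, h0, h1, d, hd, h2⟩
  · ext s
    simp only [Set.mem_ofPred_eq, Set.mem_iUnion, exists_prop]
    constructor
    · intro hs
      obtain ⟨a, h0, h1, h2⟩ := key s hs
      exact ⟨a, ⟨h0, h1, s, hs, h2⟩, h2⟩
    · rintro ⟨a, ⟨-, -, d, hd, hda⟩, hs⟩
      obtain ⟨g, hg, rfl⟩ := hE.exists_conj_of_unitaryReflections hda hs
      exact hnormal g hg d hd

end IsUnitaryRootSet
end Group
-- The projective space of V₄ and its polarity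
section Space

variable {V : Type*} [AddCommGroup V] [Module (ZMod 2) V] [Module F4 V]

/-- The space of vectors of an `F4`-subspace, over the field with two elements. -/
noncomputable def asF2 (U : Submodule F4 V) : Submodule (ZMod 2) V :=
  AddSubgroup.toZModSubmodule 2 U.toAddSubgroup

lemma mem_asF2 {U : Submodule F4 V} {x : V} : x ∈ asF2 U ↔ x ∈ U := Iff.rfl

lemma asF2_le {U W : Submodule F4 V} : asF2 U ≤ asF2 W ↔ U ≤ W := Iff.rfl

lemma asF2_injective : Function.Injective (asF2 : Submodule F4 V → Submodule (ZMod 2) V) :=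
  fun _ _ h => le_antisymm (asF2_le.1 h.le) (asF2_le.1 h.ge)

lemma asF2_sup (U W : Submodule F4 V) : asF2 (U ⊔ W) = asF2 U ⊔ asF2 W := by
  ext x
  rw [mem_asF2, Submodule.mem_sup, Submodule.mem_sup]
  rfl

lemma finrank_asF2 (U : Submodule F4 V) [FiniteDimensional F4 U] :
    Module.finrank (ZMod 2) (asF2 U) = 2 * Module.finrank F4 U := by
  have h1 := Module.natCard_eq_pow_finrank (K := F4) (V := U)
  have hfin : Finite U := Module.finite_of_finite F4
  have hfin' : Finite (asF2 U) := hfin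
  have : Module.Finite (ZMod 2) (asF2 U) := Module.Finite.of_finite
  have h2 := Module.natCard_eq_pow_finrank (K := ZMod 2) (V := asF2 U)
  have h3 : Nat.card (asF2 U) = Nat.card U := rfl
  rw [h1, h2, F4.natCard, Nat.card_zmod, show 4 = 2 ^ 2 by norm_num, ← pow_mul] at h3
  exact Nat.pow_right_injective (le_refl 2) h3

/-- The projective point spanned by a vector. -/
noncomputable def pt (x : V) : Submodule (ZMod 2) V := asF2 (Submodule.span F4 {x})

lemma mem_pt {x y : V} : y ∈ pt x ↔ ∃ c : F4, c • x = y := by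
  rw [pt, mem_asF2, Submodule.mem_span_singleton]

lemma self_mem_pt (x : V) : x ∈ pt x := mem_pt.2 ⟨1, one_smul _ _⟩

lemma pt_le {x : V} {U : Submodule F4 V} : pt x ≤ asF2 U ↔ x ∈ U := by
  rw [pt, asF2_le, Submodule.span_singleton_le_iff_mem]

lemma finrank_pt {x : V} (hx : x ≠ 0) : Module.finrank (ZMod 2) (pt x) = 2 := by
  rw [pt, finrank_asF2, finrank_span_singleton hx]

lemma pt_eq_of_mem {x y : V} (hy : y ≠ 0) (h : y ∈ pt x) : pt y = pt x := by
  obtain ⟨c, rfl⟩ := mem_pt.1 h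
  have hc : c ≠ 0 := left_ne_zero_of_smul hy
  rw [pt, pt, Submodule.span_singleton_smul_eq (IsUnit.mk0 c hc)]

lemma pt_inf_pt {x y : V} (h : pt x ≠ pt y) : pt x ⊓ pt y = ⊥ := by
  rw [Submodule.eq_bot_iff]
  rintro z ⟨h1, h2⟩
  by_contra h0
  exact h ((pt_eq_of_mem h0 h1).symm.trans (pt_eq_of_mem h0 h2))

/-- The points of a subspace. -/
def pts (U : Submodule F4 V) : Set (Submodule (ZMod 2) V) := {p | ∃ x ∈ U, x ≠ 0 ∧ p = pt x}

lemma pt_mem_pts {U : Submodule F4 V} {x : V} (hx : x ≠ 0) : pt x ∈ pts U ↔ x ∈ U := by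
  constructor
  · rintro ⟨y, hy, -, h⟩
    exact pt_le.1 (h ▸ pt_le.2 hy)
  · exact fun h => ⟨x, h, hx, rfl⟩

lemma mem_pts_iff {U : Submodule F4 V} {p : Submodule (ZMod 2) V} :
    p ∈ pts U ↔ p ∈ pts (⊤ : Submodule F4 V) ∧ p ≤ asF2 U := by
  constructor
  · rintro ⟨x, hx, h0, rfl⟩
    exact ⟨⟨x, trivial, h0, rfl⟩, pt_le.2 hx⟩
  · rintro ⟨⟨x, -, h0, rfl⟩, h⟩
    exact ⟨x, pt_le.1 h, h0, rfl⟩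

lemma ncard_pts {U : Submodule F4 V} (hU : Module.finrank F4 U = 2) : (pts U).ncard = 5 := by
  let f : Projectivization F4 U → Submodule (ZMod 2) V :=
    fun p => asF2 (p.submodule.map U.subtype)
  have hf : Function.Injective f := fun p q h => Projectivization.submodule_injective
    (Submodule.map_injective_of_injective U.injective_subtype (asF2_injective h))
  have hmk : ∀ (x : U) (hx : x ≠ 0), f (Projectivization.mk F4 x hx) = pt (x : V) := fun x hx => by
    change asF2 (Submodule.map U.subtype (Projectivization.mk F4 x hx).submodule) = _
    rw [Projectivization.submodule_mk, Submodule.map_span, Set.image_singleton]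
    rfl
  have hr : pts U = Set.range f := by
    ext p
    constructor
    · rintro ⟨x, hx, h0, rfl⟩
      exact ⟨Projectivization.mk F4 ⟨x, hx⟩ (fun h => h0 (congrArg Subtype.val h)), hmk _ _⟩
    · rintro ⟨q, rfl⟩
      induction q with
      | h x hx => exact ⟨x, x.2, fun h => hx (Subtype.ext h), hmk x hx⟩
  have := Projectivization.card_of_finrank_two F4 U hU
  rw [hr, Set.ncard_range_of_injective hf, this, F4.natCard]

lemma finite_pts {U : Submodule F4 V} (hU : Module.finrank F4 U = 2) : (pts U).Finite :=
  Set.finite_of_ncard_ne_zero (by rw [ncard_pts hU]; norm_num)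

lemma isSpread_pts {U : Submodule F4 V} (hU : Module.finrank F4 U = 2) :
    IsSpread (asF2 U) (pts U) := by
  have : FiniteDimensional F4 U := Module.finite_of_finrank_pos (by omega)
  refine ⟨by rw [finrank_asF2, hU], ncard_pts hU, ?_, ?_⟩
  · rintro _ ⟨x, hx, h0, rfl⟩
    exact ⟨pt_le.2 hx, finrank_pt h0⟩
  · rintro _ ⟨x, hx, -, rfl⟩ _ ⟨y, hy, -, rfl⟩ h
    exact pt_inf_pt h

lemma finrank_span_pair {x y : V} (hx : x ≠ 0) (hy : y ∉ pt x) :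
    Module.finrank F4 (Submodule.span F4 {x, y}) = 2 := by
  have h1 : LinearIndependent F4 ![x, y] :=
    (LinearIndependent.pair_iff' hx).2 fun a ha => hy (mem_pt.2 ⟨a, ha⟩)
  have := finrank_span_eq_card h1
  rwa [Matrix.range_cons_cons_empty, Fintype.card_fin] at this

lemma span_pair_eq {U : Submodule F4 V} (hU : Module.finrank F4 U = 2) {x y : V} (hx : x ≠ 0)
    (hy : y ∉ pt x) (hxU : x ∈ U) (hyU : y ∈ U) : Submodule.span F4 {x, y} = U := by
  have : FiniteDimensional F4 U := Module.finite_of_finrank_pos (by omega)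
  refine Submodule.eq_of_le_of_finrank_le ?_ (by rw [hU, finrank_span_pair hx hy])
  rw [Submodule.span_le]
  rintro z (rfl | rfl)
  exacts [hxU, hyU]

lemma asF2_span_pair (x y : V) : asF2 (Submodule.span F4 {x, y}) = pt x ⊔ pt y := by
  rw [Submodule.span_insert, asF2_sup]
  rfl

lemma notMem_pt_of_ne {x y : V} (hy : y ≠ 0) (h : pt x ≠ pt y) : y ∉ pt x := fun h' =>
  h (pt_eq_of_mem hy h').symm

/-- The blocks of the projective space. -/
def projBlocks (V : Type*) [AddCommGroup V] [Module (ZMod 2) V] [Module F4 V] :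
    Set (Set (Submodule (ZMod 2) V)) :=
  {b | ∃ U : Submodule F4 V, Module.finrank F4 U = 2 ∧ b = pts U}

lemma isProjectiveSpaceOf_pts : IsProjectiveSpaceOf V (pts (⊤ : Submodule F4 V)) (projBlocks V) := by
  refine ⟨fun p => ?_, fun b => ?_⟩
  · constructor
    · rintro ⟨x, -, h0, rfl⟩
      exact ⟨Submodule.span F4 {x}, finrank_span_singleton h0, rfl⟩
    · rintro ⟨U, hU, hp⟩
      obtain ⟨v, hv, hw⟩ := finrank_eq_one_iff'.1 hU
      have h0 : (v : V) ≠ 0 := fun h => hv (Subtype.ext h)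
      refine ⟨v, trivial, h0, ?_⟩
      ext x
      rw [← SetLike.mem_coe, hp, SetLike.mem_coe, mem_pt]
      constructor
      · intro hx
        obtain ⟨c, hc⟩ := hw ⟨x, hx⟩
        exact ⟨c, congrArg Subtype.val hc⟩
      · rintro ⟨c, rfl⟩
        exact U.smul_mem c v.2
  · refine exists_congr fun U => and_congr_right fun _ => ?_
    have h1 : pts U = {p | p ∈ pts (⊤ : Submodule F4 V) ∧ (p : Set V) ⊆ U} := by
      ext p
      exact mem_pts_iff
    rw [h1]

lemma isProjectiveSpace_pts : IsProjectiveSpace (pts (⊤ : Submodule F4 V)) (projBlocks V) 4 := by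
  have hjoin : ∀ U W : Submodule F4 V, Module.finrank F4 U = 2 → Module.finrank F4 W = 2 →
      ∀ x y : V, x ≠ 0 → y ≠ 0 → pt x ≠ pt y → x ∈ U → y ∈ U → x ∈ W → y ∈ W → U = W := by
    intro U W hU hW x y hx hy hne hxU hyU hxW hyW
    rw [← span_pair_eq hU hx (notMem_pt_of_ne hy hne) hxU hyU,
      span_pair_eq hW hx (notMem_pt_of_ne hy hne) hxW hyW]
  refine ⟨?_, ?_, ?_, ?_⟩
  · rintro _ ⟨U, -, rfl⟩ _ ⟨x, -, h0, rfl⟩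
    exact ⟨x, trivial, h0, rfl⟩
  · rintro _ ⟨U, hU, rfl⟩
    exact ncard_pts hU
  · rintro _ ⟨x, -, hx, rfl⟩ _ ⟨y, -, hy, rfl⟩ hne
    have hf := finrank_span_pair hx (notMem_pt_of_ne hy hne)
    have hxU : x ∈ Submodule.span F4 {x, y} := Submodule.subset_span (by simp)
    have hyU : y ∈ Submodule.span F4 {x, y} := Submodule.subset_span (by simp)
    refine ⟨pts (Submodule.span F4 {x, y}), ⟨⟨_, hf, rfl⟩, (pt_mem_pts hx).2 hxU,
      (pt_mem_pts hy).2 hyU⟩, ?_⟩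
    rintro _ ⟨⟨W, hW, rfl⟩, h1, h2⟩
    rw [hjoin W _ hW hf x y hx hy hne ((pt_mem_pts hx).1 h1) ((pt_mem_pts hy).1 h2) hxU hyU]
  -- A block meeting two given blocks away from their common point is spanned by the two
  -- intersection points, hence lies in the sum of the planes.
  · have hmem : ∀ U₁ U₂ W : Submodule F4 V, Module.finrank F4 U₁ = 2 → Module.finrank F4 U₂ = 2 →
        Module.finrank F4 W = 2 → U₁ ≠ U₂ → ∀ x, x ≠ 0 → x ∈ U₁ → x ∈ U₂ →
        (∃ y ∈ pts W ∩ pts U₁, y ≠ pt x) → (∃ y ∈ pts W ∩ pts U₂, y ≠ pt x) → W ≤ U₁ ⊔ U₂ := by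
      rintro U₁ U₂ W h₁ h₂ hW hne x hx hx₁ hx₂ ⟨_, ⟨hyW, ⟨y, hy, hy0, rfl⟩⟩, hyx⟩
        ⟨_, ⟨hzW, ⟨z, hz, hz0, rfl⟩⟩, hzx⟩
      rw [pt_mem_pts hy0] at hyW
      rw [pt_mem_pts hz0] at hzW
      have hyz : pt y ≠ pt z := fun heq => hne
        (hjoin U₁ U₂ h₁ h₂ x y hx hy0 hyx.symm hx₁ hy hx₂ (pt_le.1 (heq ▸ pt_le.2 hz)))
      rw [← span_pair_eq hW hy0 (notMem_pt_of_ne hz0 hyz) hyW hzW, Submodule.span_le]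
      rintro w (rfl | rfl)
      exacts [Submodule.mem_sup_left hy, Submodule.mem_sup_right hz]
    rintro _ ⟨U₁, h₁, rfl⟩ _ ⟨U₂, h₂, rfl⟩ _ ⟨W₁, hW₁, rfl⟩ _ ⟨W₂, hW₂, rfl⟩ _ hne
      ⟨x, hx₁, hx, rfl⟩ hx₂ hy₁ hy₂ hz₁ hz₂
    rw [pt_mem_pts hx] at hx₂
    have hne' : U₁ ≠ U₂ := fun h => hne (by rw [h])
    have hl₁ := hmem U₁ U₂ W₁ h₁ h₂ hW₁ hne' x hx hx₁ hx₂ hy₁ hy₂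
    have hl₂ := hmem U₁ U₂ W₂ h₁ h₂ hW₂ hne' x hx hx₁ hx₂ hz₁ hz₂
    have f₁ : FiniteDimensional F4 U₁ := Module.finite_of_finrank_pos (by omega)
    have f₂ : FiniteDimensional F4 U₂ := Module.finite_of_finrank_pos (by omega)
    have f₃ : FiniteDimensional F4 W₁ := Module.finite_of_finrank_pos (by omega)
    have f₄ : FiniteDimensional F4 W₂ := Module.finite_of_finrank_pos (by omega)
    -- The sum of U₁ and U₂ has dimension at most three, so two planes inside it meet nontrivially.
    have hpos : 0 < Module.finrank F4 (U₁ ⊓ U₂ : Submodule F4 V) := by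
      rw [Module.finrank_pos_iff]
      exact ⟨⟨⟨x, hx₁, hx₂⟩, 0, fun h => hx (congrArg Subtype.val h)⟩⟩
    have d1 := Submodule.finrank_sup_add_finrank_inf_eq U₁ U₂
    have d2 := Submodule.finrank_sup_add_finrank_inf_eq W₁ W₂
    have d3 := Submodule.finrank_mono (sup_le hl₁ hl₂)
    have hpos' : 0 < Module.finrank F4 (W₁ ⊓ W₂ : Submodule F4 V) := by omega
    rw [Module.finrank_pos_iff] at hpos'
    obtain ⟨⟨z, hz₁', hz₂'⟩, hz0⟩ := exists_ne (0 : (W₁ ⊓ W₂ : Submodule F4 V))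
    have hz0' : z ≠ 0 := fun h => hz0 (Subtype.ext h)
    exact ⟨pt z, (pt_mem_pts hz0').2 hz₁', (pt_mem_pts hz0').2 hz₂'⟩

/-- The points orthogonal to `p`. -/
def perpPoints (h : V →ₗ[F4] V →ₛₗ[frobenius F4 2] F4) (p : Submodule (ZMod 2) V) :
    Set (Submodule (ZMod 2) V) :=
  {q ∈ pts (⊤ : Submodule F4 V) | ∀ x ∈ p, ∀ y ∈ q, h x y = 0}

lemma pt_mem_perpPoints {h : V →ₗ[F4] V →ₛₗ[frobenius F4 2] F4} {x y : V} (hy : y ≠ 0) :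
    pt y ∈ perpPoints h (pt x) ↔ h x y = 0 := by
  constructor
  · exact fun hp => hp.2 x (self_mem_pt x) y (self_mem_pt y)
  · intro hxy
    refine ⟨⟨y, trivial, hy, rfl⟩, fun z hz w hw => ?_⟩
    obtain ⟨c, rfl⟩ := mem_pt.1 hz
    obtain ⟨d, rfl⟩ := mem_pt.1 hw
    rw [form_smul_left, form_smul_right, hxy, mul_zero, mul_zero]

lemma isHermitianPolarity_perpPoints {h : V →ₗ[F4] V →ₛₗ[frobenius F4 2] F4}
    (hh : IsNondegHermitian h) :
    IsHermitianPolarity h (pts (⊤ : Submodule F4 V)) (projBlocks V) (perpPoints h) := by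
  have hsymm : ∀ x y, h x y = 0 → h y x = 0 := fun x y hxy => by
    rw [hh.hermitian x y, hxy]; simp
  refine { hyperplane := ?_, injOn := ?_, symm := ?_, perp := fun p _ => rfl }
  · rintro _ ⟨x, -, hx, rfl⟩
    refine ⟨fun q hq => hq.1, ?_, ?_, ?_⟩
    · intro heq
      refine hx (hh.nondegenerate x fun y => ?_)
      by_cases hy : y = 0
      · rw [hy, map_zero]
      · rw [← pt_mem_perpPoints hy, heq]
        exact ⟨y, trivial, hy, rfl⟩
    · rintro _ ⟨U, hU, rfl⟩ _ ⟨⟨y, hyU, hy, rfl⟩, hy'⟩ _ ⟨⟨z, hzU, hz, rfl⟩, hz'⟩ hne _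
        ⟨w, hwU, hw, rfl⟩
      rw [pt_mem_perpPoints hy] at hy'
      rw [pt_mem_perpPoints hz] at hz'
      rw [pt_mem_perpPoints hw]
      rw [← span_pair_eq hU hy (notMem_pt_of_ne hz hne) hyU hzU] at hwU
      obtain ⟨a, b, rfl⟩ := Submodule.mem_span_pair.1 hwU
      rw [map_add, form_smul_right, form_smul_right, hy', hz', mul_zero, mul_zero, add_zero]
    · rintro _ ⟨U, hU, rfl⟩
      have : FiniteDimensional F4 U := Module.finite_of_finrank_pos (by omega)
      obtain ⟨y, hy, hy0⟩ : ∃ y ∈ U, y ≠ 0 ∧ h y x = 0 := by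
        let f : U →ₗ[F4] F4 := (h.flip x).comp U.subtype
        have h1 : 0 < Module.finrank F4 (LinearMap.ker f) := by
          have h2 := LinearMap.finrank_range_add_finrank_ker f
          have h3 := Submodule.finrank_le (LinearMap.range f)
          rw [Module.finrank_self] at h3
          omega
        rw [Module.finrank_pos_iff] at h1
        obtain ⟨⟨z, hz⟩, hz0⟩ := exists_ne (0 : LinearMap.ker f)
        exact ⟨z, z.2, fun h => hz0 (Subtype.ext (Subtype.ext h)), hz⟩
      exact ⟨pt y, (pt_mem_pts hy0.1).2 hy, (pt_mem_perpPoints hy0.1).2 (hsymm _ _ hy0.2)⟩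
  · rintro _ ⟨x, -, hx, rfl⟩ _ ⟨y, -, hy, rfl⟩ heq
    have h1 : ∀ z, h z x = 0 → h z y = 0 := fun z hz => by
      by_cases hz0 : z = 0
      · rw [hz0, map_zero, LinearMap.zero_apply]
      · apply hsymm
        rw [← pt_mem_perpPoints hz0, ← heq, pt_mem_perpPoints hz0]
        exact hsymm _ _ hz
    -- Equal polar hyperplanes mean that the kernel of h(·,x) lies in that of h(·,y), so the
    -- functionals are proportional; nondegeneracy transfers this to x and y.
    have h2 := mem_span_of_iInf_ker_le_ker (L := fun _ : Unit => h.flip x) (K := h.flip y) (by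
      rw [iInf_const]
      exact h1)
    rw [Set.range_const, Submodule.mem_span_singleton] at h2
    obtain ⟨a, ha⟩ := h2
    have h3 : y = a ^ 2 • x := by
      rw [← sub_eq_zero]
      refine hh.nondegenerate _ fun z => hsymm _ _ ?_
      have h4 : a * h z x = h z y := LinearMap.congr_fun ha z
      rw [map_sub, form_smul_right, ← pow_mul, F4.pow_four, h4, sub_self]
    exact (pt_eq_of_mem hy (mem_pt.2 ⟨_, h3.symm⟩)).symm
  · rintro _ ⟨x, -, hx, rfl⟩ _ ⟨y, -, hy, rfl⟩ hxy
    rw [pt_mem_perpPoints hy] at hxy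
    rw [pt_mem_perpPoints hx]
    exact hsymm _ _ hxy

end Space
-- Lines, singular lines and spreads in terms of the form
section Geometry

variable {V : Type*} [AddCommGroup V] [Module (ZMod 2) V] [Module F4 V]

namespace IsUnitaryRootSet

variable {h : V →ₗ[F4] V →ₛₗ[frobenius F4 2] F4} {E : Set (V ≃ₗ[ZMod 2] V)}
  (hE : IsUnitaryRootSet h E) {u v : V}

include hE

lemma comm_eq_pt {e : V ≃ₗ[ZMod 2] V} (he : e ∈ E) (hv : v ∈ comm e) (h0 : v ≠ 0) :
    comm e = pt v := by
  ext x
  rw [mem_pt]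
  constructor
  · intro hx
    obtain ⟨c, hc⟩ := hE.exists_smul_eq he hv h0 hx
    exact ⟨c, hc.symm⟩
  · rintro ⟨c, rfl⟩
    exact hE.smul_mem_comm he hv c

lemma exists_comm_eq_pt (hv : h v v = 1) : ∃ e ∈ E, v ∈ comm e ∧ comm e = pt v := by
  obtain ⟨e, he, hve, h0⟩ := hE.lineVector_iff.2 hv
  exact ⟨e, he, hve, hE.comm_eq_pt he hve h0⟩

lemma exists_of_mem {e : V ≃ₗ[ZMod 2] V} (he : e ∈ E) : ∃ v ∈ comm e, v ≠ 0 ∧ h v v = 1 ∧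
    comm e = pt v := by
  obtain ⟨v, hv, h0⟩ := hE.exists_ne_zero he
  exact ⟨v, hv, h0, hE.lineVector_form ⟨e, he, hv, h0⟩, hE.comm_eq_pt he hv h0⟩

lemma mem_dLines_iff {p : Submodule (ZMod 2) V} : p ∈ dLines E ↔ ∃ v, h v v = 1 ∧ p = pt v := by
  constructor
  · rintro ⟨e, he, rfl⟩
    obtain ⟨v, -, -, hv, h1⟩ := hE.exists_of_mem he
    exact ⟨v, hv, h1⟩
  · rintro ⟨v, hv, rfl⟩
    obtain ⟨e, he, -, h1⟩ := hE.exists_comm_eq_pt hv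
    exact ⟨e, he, h1.symm⟩

omit hE [Module (ZMod 2) V] in
lemma ne_zero_of_form (hv : h v v = 1) : v ≠ 0 := by
  rintro rfl
  simp at hv

omit hE in
lemma form_of_mem_pt {x y : V} (hy : y ∈ pt x) (hy0 : y ≠ 0) : h y y = h x x := by
  obtain ⟨c, rfl⟩ := mem_pt.1 hy
  have hc := F4.pow_three (left_ne_zero_of_smul hy0)
  rw [form_smul_left, form_smul_right]
  linear_combination h x x * hc

lemma pt_mem_dLines {x : V} (hx : x ≠ 0) : pt x ∈ dLines E ↔ h x x = 1 := by
  rw [hE.mem_dLines_iff]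
  constructor
  · rintro ⟨v, hv, hp⟩
    rw [form_of_mem_pt (hp ▸ self_mem_pt x) hx, hv]
  · exact fun hv => ⟨x, hv, rfl⟩

lemma pt_notMem_dLines {x : V} (hx : x ≠ 0) : pt x ∉ dLines E ↔ h x x = 0 := by
  rw [hE.pt_mem_dLines hx]
  rcases hE.form_self x with h1 | h1 <;> simp [h1]

lemma form_ne_zero_of_not_le_cent {d : V ≃ₗ[ZMod 2] V} (hd : d ∈ E) (hv : v ∈ comm d)
    (hv0 : v ≠ 0) {x : V} : ¬ pt x ≤ cent d ↔ h x v ≠ 0 := by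
  obtain ⟨-, a, ha0, -, ha⟩ := hE.root d hd v hv hv0
  rw [not_iff_comm, not_not]
  constructor
  · intro hx y hy
    obtain ⟨c, rfl⟩ := mem_pt.1 hy
    rw [mem_cent, ha, form_smul_left, hx, mul_zero, mul_zero, zero_smul, add_zero]
  · intro hle
    have h1 := mem_cent.1 (hle (self_mem_pt x))
    rw [ha, add_eq_left, smul_eq_zero, mul_eq_zero] at h1
    exact (h1.resolve_right hv0).resolve_left ha0

/-- A two-dimensional subspace spanned by two vectors of norm one with product one contains
just one isotropic point. -/
lemma mem_pt_of_isotropic (hu : h u u = 1) (hv : h v v = 1) (huv : h u v = 1) {x : V}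
    (hx : x ∈ Submodule.span F4 {u, v}) (hxx : h x x = 0) : x ∈ pt (u + v) := by
  obtain ⟨a, b, rfl⟩ := Submodule.mem_span_pair.1 hx
  have h1 : h (a • u + b • v) (a • u + b • v) = a ^ 3 + a * b ^ 2 + a ^ 2 * b + b ^ 3 := by
    simp only [map_add, LinearMap.add_apply, map_smul, LinearMap.smul_apply, map_smulₛₗ,
      frobenius_def, smul_eq_mul, hu, hv, huv, hE.herm u v]
    ring
  rw [h1] at hxx
  -- The norm of au + bv is (a + b)³ in characteristic two, so isotropic vectors have a = b.
  have h2 : (a + b) ^ 3 = 0 := by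
    linear_combination hxx + (a ^ 2 * b + a * b ^ 2) * F4.two_eq_zero
  have h3 : a = b := F4.eq_of_add_eq_zero (pow_eq_zero_iff (by norm_num) |>.1 h2)
  exact mem_pt.2 ⟨b, by rw [h3, smul_add]⟩

omit hE in
lemma notMem_pt_of_form (hu : h u u = 1) (huv : h u v = 1) (hne : u ≠ v) : v ∉ pt u := by
  intro hmem
  obtain ⟨c, rfl⟩ := mem_pt.1 hmem
  rw [form_smul_right, hu, mul_one] at huv
  have h1 : c = 1 := by
    have h2 := F4.pow_four c
    linear_combination - h2 + (c ^ 2 + 1) * huv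
  exact hne (by rw [h1, one_smul])

lemma tangent_pts (hu : h u u = 1) (hv : h v v = 1) (huv : h u v = 1) (hne : u ≠ v) :
    pts (Submodule.span F4 {u, v}) ∈ tangentSpreads E := by
  obtain ⟨d, hd, hud, hdu⟩ := hE.exists_comm_eq_pt hu
  obtain ⟨e, he, hve, hev⟩ := hE.exists_comm_eq_pt hv
  have hu0 := ne_zero_of_form hu
  have hv0 := ne_zero_of_form hv
  have hmem := notMem_pt_of_form hu huv hne
  have hU := finrank_span_pair hu0 hmem
  have hW : comm d ⊔ comm e = asF2 (Submodule.span F4 {u, v}) := by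
    rw [asF2_span_pair, hdu, hev]
  have huv0 : u + v ≠ 0 := fun h' => hne (eq_of_add_eq_zero' h')
  have hiso : h (u + v) (u + v) = 0 := by
    rw [map_add, form_add_left, form_add_left, hu, hv, hE.herm u v, huv]
    linear_combination 2 * F4.two_eq_zero
  have huvU : u + v ∈ Submodule.span F4 {u, v} :=
    Submodule.add_mem _ (Submodule.subset_span (by simp)) (Submodule.subset_span (by simp))
  have hset : {l ∈ dLines E | l ≤ asF2 (Submodule.span F4 {u, v})} =
      pts (Submodule.span F4 {u, v}) \ {pt (u + v)} := by
    ext l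
    constructor
    · rintro ⟨hl, hle⟩
      obtain ⟨x, hx, rfl⟩ := hE.mem_dLines_iff.1 hl
      refine ⟨(pt_mem_pts (ne_zero_of_form hx)).2 (pt_le.1 hle), fun heq => ?_⟩
      rw [Set.mem_singleton_iff] at heq
      exact (hE.pt_notMem_dLines huv0).2 hiso (heq ▸ hl)
    · rintro ⟨⟨x, hx, hx0, rfl⟩, hne'⟩
      refine ⟨?_, pt_le.2 hx⟩
      rw [hE.pt_mem_dLines hx0]
      refine (hE.form_self x).resolve_left fun hxx => hne' ?_
      exact pt_eq_of_mem hx0 (hE.mem_pt_of_isotropic hu hv huv hx hxx)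
  refine ⟨d, hd, e, he, ?_, ?_, ?_, ?_, ?_⟩
  · rw [hdu, hev]
    exact fun h' => hmem (h' ▸ self_mem_pt v)
  · rw [hev, hE.form_ne_zero_of_not_le_cent hd hud hu0, hE.herm u v, huv]
    simp
  · rw [hW, hset, Set.ncard_sdiff_singleton_of_mem ((pt_mem_pts huv0).2 huvU), ncard_pts hU]
  · rw [hW]
    exact isSpread_pts hU
  · rw [hW, hset]
    exact Set.sdiff_subset

/-- A tangent spread is given only over F₂. After scaling to h(u,v) = 1, its fifth member avoids
every vector of norm one in the sum, so it consists of isotropic vectors and must be the unique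
isotropic point. -/
lemma exists_of_tangent {S : Set (Submodule (ZMod 2) V)} (hS : S ∈ tangentSpreads E) :
    ∃ U : Submodule F4 V, Module.finrank F4 U = 2 ∧ S = pts U := by
  obtain ⟨d, hd, e, he, hne, hcent, -, hspread, hsub⟩ := hS
  obtain ⟨u, hud, hu0, hu, hdu⟩ := hE.exists_of_mem hd
  obtain ⟨v', hve', hv0', hv', hev'⟩ := hE.exists_of_mem he
  have hvu' : h u v' ≠ 0 := by
    rw [hev', hE.form_ne_zero_of_not_le_cent hd hud hu0] at hcent
    exact fun h' => hcent (hE.form_eq_zero_symm h')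
  obtain ⟨b, hb0, huv⟩ := exists_smul_form_eq hvu' one_ne_zero
  set v := b • v'
  have hve : v ∈ comm e := hE.smul_mem_comm he hve' b
  have hv0 : v ≠ 0 := smul_ne_zero hb0 hv0'
  have hv : h v v = 1 := hE.lineVector_form ⟨e, he, hve, hv0⟩
  have hev := hE.comm_eq_pt he hve hv0
  have hmem : v ∉ pt u := notMem_pt_of_ne hv0 (by rwa [← hdu, ← hev])
  have hU := finrank_span_pair hu0 hmem
  rw [hdu, hev, ← asF2_span_pair] at hspread hsub
  refine ⟨_, hU, Set.eq_of_subset_of_ncard_le ?_ (by rw [ncard_pts hU, hspread.2.1])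
    (finite_pts hU)⟩
  intro s hs
  obtain ⟨hsW, hs2⟩ := hspread.2.2.1 s hs
  by_cases hsL : s ∈ dLines E
  · obtain ⟨x, hx, rfl⟩ := hE.mem_dLines_iff.1 hsL
    exact (pt_mem_pts (ne_zero_of_form hx)).2 (pt_le.1 hsW)
  · have hle : s ≤ pt (u + v) := by
      intro y hy
      refine hE.mem_pt_of_isotropic hu hv huv (hsW hy) ((hE.form_self y).resolve_right fun hyy => ?_)
      have hy0 := ne_zero_of_form hyy
      have hyL := (hE.pt_mem_dLines hy0).2 hyy
      have h1 : pt y ∈ S := hsub ⟨hyL, pt_le.2 (hsW hy)⟩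
      have h2 := hspread.2.2.2 s hs (pt y) h1 (fun h' => hsL (h' ▸ hyL))
      have h3 : y ∈ s ⊓ pt y := ⟨hy, self_mem_pt y⟩
      rw [h2] at h3
      exact hy0 h3
    have huv0 : u + v ≠ 0 := fun h' => hmem (eq_of_add_eq_zero' h' ▸ self_mem_pt u)
    have hfin : FiniteDimensional (ZMod 2) (pt (u + v)) :=
      Module.finite_of_finrank_pos (by rw [finrank_pt huv0]; norm_num)
    rw [Submodule.eq_of_le_of_finrank_le hle (by rw [finrank_pt huv0, hs2])]
    refine (pt_mem_pts huv0).2 (Submodule.add_mem _ (Submodule.subset_span (by simp))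
      (Submodule.subset_span (by simp)))

lemma mem_singularLines_iff {p : Submodule (ZMod 2) V} :
    p ∈ singularLines E ↔ ∃ x, x ≠ 0 ∧ h x x = 0 ∧ p = pt x := by
  constructor
  · rintro ⟨S, hS, hpS, hp⟩
    obtain ⟨U, -, rfl⟩ := hE.exists_of_tangent hS
    obtain ⟨x, -, hx0, rfl⟩ := hpS
    exact ⟨x, hx0, (hE.pt_notMem_dLines hx0).1 hp, rfl⟩
  · rintro ⟨x, hx0, hx, rfl⟩
    obtain ⟨-, l, m, hl, hm, hlm, hx'⟩ := hE.singularVector_iff.2 ⟨hx0, hx⟩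
    refine ⟨_, hE.tangent_pts (hE.lineVector_form hl) (hE.lineVector_form hm) hlm ?_, ?_,
      (hE.pt_notMem_dLines hx0).2 hx⟩
    · rintro rfl
      rw [two_add] at hx'
      exact hx0 hx'
    · rw [pt_mem_pts hx0, hx']
      exact Submodule.add_mem _ (Submodule.subset_span (by simp)) (Submodule.subset_span (by simp))

lemma geomPoints_eq : geomPoints E = pts (⊤ : Submodule F4 V) := by
  ext p
  rw [geomPoints, Set.mem_union, hE.mem_dLines_iff, hE.mem_singularLines_iff]
  constructor
  · rintro (⟨x, hx, rfl⟩ | ⟨x, h0, -, rfl⟩)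
    · exact ⟨x, trivial, ne_zero_of_form hx, rfl⟩
    · exact ⟨x, trivial, h0, rfl⟩
  · rintro ⟨x, -, h0, rfl⟩
    rcases hE.form_self x with hx | hx
    · exact Or.inr ⟨x, h0, hx, rfl⟩
    · exact Or.inl ⟨x, hx, rfl⟩

lemma setOf_points_le (U : Submodule F4 V) :
    {l ∈ dLines E ∪ singularLines E | l ≤ asF2 U} = pts U := by
  ext p
  rw [mem_pts_iff, ← hE.geomPoints_eq]
  rfl

lemma exists_of_hyperbolic {S : Set (Submodule (ZMod 2) V)} (hS : S ∈ hyperbolicSpreads E) :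
    ∃ U : Submodule F4 V, Module.finrank F4 U = 2 ∧ S = pts U := by
  obtain ⟨d, hd, s, hs, -, rfl⟩ := hS
  obtain ⟨v, -, hv0, hv, hdv⟩ := hE.exists_of_mem hd
  obtain ⟨x, hx0, hx, rfl⟩ := hE.mem_singularLines_iff.1 hs
  refine ⟨Submodule.span F4 {v, x}, finrank_span_pair hv0 fun hmem => ?_, ?_⟩
  · rw [form_of_mem_pt hmem hx0, hv] at hx
    exact one_ne_zero hx
  · rw [hdv, ← asF2_span_pair, hE.setOf_points_le]

/-- Two members already span the 4-space over F₂, which is therefore an F4-plane and contains all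
five members as points. -/
lemma exists_of_singular {S : Set (Submodule (ZMod 2) V)} (hS : S ∈ singularSpreads E) :
    ∃ U : Submodule F4 V, Module.finrank F4 U = 2 ∧ S = pts U := by
  obtain ⟨⟨W, hW⟩, hsub⟩ := hS
  obtain ⟨p, hp, q, hq, hne⟩ := (Set.one_lt_ncard_iff (Set.finite_of_ncard_ne_zero
    (by rw [hW.2.1]; norm_num))).1 (by rw [hW.2.1]; norm_num : 1 < S.ncard) |>.imp fun p hp => by
      obtain ⟨q, hp, hq, hne⟩ := hp
      exact (⟨hp, q, hq, hne⟩ : p ∈ S ∧ ∃ q, q ∈ S ∧ p ≠ q)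
  obtain ⟨x, hx0, -, rfl⟩ := hE.mem_singularLines_iff.1 (hsub hp)
  obtain ⟨y, hy0, -, rfl⟩ := hE.mem_singularLines_iff.1 (hsub hq)
  have hU := finrank_span_pair hx0 (notMem_pt_of_ne hy0 hne)
  have hfin : FiniteDimensional F4 (Submodule.span F4 {x, y}) :=
    Module.finite_of_finrank_pos (by omega)
  have hfinW : FiniteDimensional (ZMod 2) W :=
    Module.finite_of_finrank_pos (by rw [hW.1]; norm_num)
  have hWU : asF2 (Submodule.span F4 {x, y}) = W := by
    refine Submodule.eq_of_le_of_finrank_le ?_ (by rw [hW.1, finrank_asF2, hU])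
    rw [asF2_span_pair]
    exact sup_le (hW.2.2.1 _ hp).1 (hW.2.2.1 _ hq).1
  refine ⟨_, hU, Set.eq_of_subset_of_ncard_le ?_ (by rw [ncard_pts hU, hW.2.1]) (finite_pts hU)⟩
  intro s hs
  obtain ⟨z, hz0, -, rfl⟩ := hE.mem_singularLines_iff.1 (hsub hs)
  rw [pt_mem_pts hz0, ← pt_le, hWU]
  exact (hW.2.2.1 _ hs).1

/-- The three kinds of blocks are the three isometry types of planes: totally isotropic planes are
singular, planes with one-dimensional radical tangent, nondegenerate planes hyperbolic. For a vector
v of norm one and y in U orthogonal to it, the norm of y decides between the last two. -/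
lemma pts_mem_geomBlocks {U : Submodule F4 V} (hU : Module.finrank F4 U = 2) :
    pts U ∈ geomBlocks E := by
  by_cases hiso : ∀ x ∈ U, h x x = 0
  · refine Or.inr ⟨⟨_, isSpread_pts hU⟩, ?_⟩
    rintro _ ⟨x, hx, h0, rfl⟩
    exact hE.mem_singularLines_iff.2 ⟨x, h0, hiso x hx, rfl⟩
  push Not at hiso
  obtain ⟨v, hvU, hv⟩ := hiso
  replace hv := (hE.form_self v).resolve_left hv
  have hv0 := ne_zero_of_form hv
  obtain ⟨y, hyU, hy0, hvy⟩ : ∃ y ∈ U, y ≠ 0 ∧ h v y = 0 := by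
    obtain ⟨z, hzU, hz⟩ : ∃ z ∈ U, z ∉ pt v := by
      by_contra! hcon
      have hle : U ≤ Submodule.span F4 {v} := fun z hz => hcon z hz
      have := Submodule.finrank_mono hle
      rw [hU, finrank_span_singleton hv0] at this
      omega
    refine ⟨z - (h v z) ^ 2 • v, U.sub_mem hzU (U.smul_mem _ hvU), fun h0 => hz ?_, ?_⟩
    · exact mem_pt.2 ⟨_, (sub_eq_zero.1 h0).symm⟩
    · rw [map_sub, form_smul_right, hv, ← pow_mul, F4.pow_four, mul_one, sub_self]
  have hyv : y ∉ pt v := fun hmem => by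
    obtain ⟨c, rfl⟩ := mem_pt.1 hmem
    rw [form_smul_right, hv, mul_one] at hvy
    rw [pow_eq_zero_iff (by norm_num)] at hvy
    exact hy0 (by rw [hvy, zero_smul])
  have hyv' : v + y ∉ pt v := fun hmem => hyv (by
    have := (pt v).add_mem (self_mem_pt v) hmem
    rwa [← add_assoc, two_add, zero_add] at this)
  have hspan := span_pair_eq hU hv0 hyv' hvU (U.add_mem hvU hyU)
  have hvvy : h v (v + y) = 1 := by rw [map_add, hv, hvy, add_zero]
  have hnorm : h (v + y) (v + y) = 1 + h y y := by
    rw [form_add_left, hvvy, map_add, hE.form_eq_zero_symm hvy, zero_add]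
  have hvy0 : v + y ≠ 0 := fun h0 => hyv' (h0 ▸ (pt v).zero_mem)
  rcases hE.form_self y with hyy | hyy
  · rw [hyy, add_zero] at hnorm
    refine Or.inl (Or.inl ?_)
    rw [← hspan]
    exact hE.tangent_pts hv hnorm hvvy (fun h' => hy0 (by simpa using h'))
  · rw [hyy, F4.add_self] at hnorm
    obtain ⟨d, hd, hvd, hdv⟩ := hE.exists_comm_eq_pt hv
    refine Or.inl (Or.inr ⟨d, hd, pt (v + y), hE.mem_singularLines_iff.2 ⟨_, hvy0, hnorm, rfl⟩,
      ?_, ?_⟩)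
    · rw [hE.form_ne_zero_of_not_le_cent hd hvd hv0, hE.herm v, hvvy]
      simp
    · rw [hdv, ← asF2_span_pair, hE.setOf_points_le, hspan]

lemma geomBlocks_eq : geomBlocks E = projBlocks V := by
  ext b
  constructor
  · rintro ((hb | hb) | hb)
    exacts [hE.exists_of_tangent hb, hE.exists_of_hyperbolic hb, hE.exists_of_singular hb]
  · rintro ⟨U, hU, rfl⟩
    exact hE.pts_mem_geomBlocks hU

lemma absolutePoints_eq :
    absolutePoints (pts (⊤ : Submodule F4 V)) (perpPoints h) = singularLines E := by
  ext p
  rw [hE.mem_singularLines_iff]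
  constructor
  · rintro ⟨⟨x, -, h0, rfl⟩, hp⟩
    exact ⟨x, h0, (pt_mem_perpPoints h0).1 hp, rfl⟩
  · rintro ⟨x, h0, hx, rfl⟩
    exact ⟨⟨x, trivial, h0, rfl⟩, (pt_mem_perpPoints h0).2 hx⟩

end IsUnitaryRootSet
end Geometry
-- Passing from D to D and its inverses; connectedness
section Reduction

variable {V : Type*} [AddCommGroup V] [Module (ZMod 2) V]

lemma cent_inv (d : V ≃ₗ[ZMod 2] V) : cent d⁻¹ = cent d := by
  have key : ∀ d : V ≃ₗ[ZMod 2] V, cent d ≤ cent d⁻¹ := fun d x hx => by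
    rw [mem_cent] at hx ⊢
    conv_lhs => rw [← hx]
    rw [← LinearEquiv.mul_apply]
    simp
  exact le_antisymm (by simpa using key d⁻¹) (key d)

/-- The members of `D` and their inverses. -/
def symmetrize (D : Set (V ≃ₗ[ZMod 2] V)) : Set (V ≃ₗ[ZMod 2] V) := {g | g ∈ D ∨ g⁻¹ ∈ D}

lemma exists_mem_symmetrize (D : Set (V ≃ₗ[ZMod 2] V)) {e : V ≃ₗ[ZMod 2] V}
    (he : e ∈ symmetrize D) : ∃ d ∈ D, comm d = comm e ∧ cent d = cent e := by
  rcases he with h | h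
  · exact ⟨e, h, rfl, rfl⟩
  · exact ⟨e⁻¹, h, comm_inv e, cent_inv e⟩

lemma subset_symmetrize (D : Set (V ≃ₗ[ZMod 2] V)) : D ⊆ symmetrize D := fun _ => Or.inl

lemma dLines_symmetrize (D : Set (V ≃ₗ[ZMod 2] V)) : dLines (symmetrize D) = dLines D := by
  ext l
  constructor
  · rintro ⟨e, he, rfl⟩
    obtain ⟨d, hd, h, -⟩ := exists_mem_symmetrize D he
    exact ⟨d, hd, h.symm⟩
  · rintro ⟨d, hd, rfl⟩
    exact ⟨d, Or.inl hd, rfl⟩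

lemma tangentSpreads_symmetrize (D : Set (V ≃ₗ[ZMod 2] V)) :
    tangentSpreads (symmetrize D) = tangentSpreads D := by
  ext S
  simp only [tangentSpreads, dLines_symmetrize, Set.mem_ofPred_eq]
  constructor
  · rintro ⟨d, hd, e, he, h⟩
    obtain ⟨d', hd', h1, h2⟩ := exists_mem_symmetrize D hd
    obtain ⟨e', he', h3, -⟩ := exists_mem_symmetrize D he
    exact ⟨d', hd', e', he', by rwa [h1, h2, h3]⟩
  · rintro ⟨d, hd, e, he, h⟩
    exact ⟨d, Or.inl hd, e, Or.inl he, h⟩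

lemma singularLines_symmetrize (D : Set (V ≃ₗ[ZMod 2] V)) :
    singularLines (symmetrize D) = singularLines D := by
  simp only [singularLines, dLines_symmetrize, tangentSpreads_symmetrize]

lemma geomPoints_symmetrize (D : Set (V ≃ₗ[ZMod 2] V)) :
    geomPoints (symmetrize D) = geomPoints D := by
  simp only [geomPoints, dLines_symmetrize, singularLines_symmetrize]

lemma hyperbolicSpreads_symmetrize (D : Set (V ≃ₗ[ZMod 2] V)) :
    hyperbolicSpreads (symmetrize D) = hyperbolicSpreads D := by
  ext S
  simp only [hyperbolicSpreads, dLines_symmetrize, singularLines_symmetrize, Set.mem_ofPred_eq]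
  constructor
  · rintro ⟨d, hd, s, hs, h⟩
    obtain ⟨d', hd', h1, h2⟩ := exists_mem_symmetrize D hd
    exact ⟨d', hd', s, hs, by rwa [h1, h2]⟩
  · rintro ⟨d, hd, h⟩
    exact ⟨d, Or.inl hd, h⟩

lemma geomBlocks_symmetrize (D : Set (V ≃ₗ[ZMod 2] V)) :
    geomBlocks (symmetrize D) = geomBlocks D := by
  simp only [geomBlocks, tangentSpreads_symmetrize, hyperbolicSpreads_symmetrize, singularSpreads,
    singularLines_symmetrize]

lemma closure_symmetrize (D : Set (V ≃ₗ[ZMod 2] V)) :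
    Subgroup.closure (symmetrize D) = Subgroup.closure D := by
  refine le_antisymm ((Subgroup.closure_le _).2 ?_) (Subgroup.closure_mono (subset_symmetrize D))
  rintro g (hg | hg)
  · exact Subgroup.subset_closure hg
  · exact inv_mem_iff.1 (Subgroup.subset_closure hg)

namespace IsRootSet

variable {E : Set (V ≃ₗ[ZMod 2] V)} (hE : IsRootSet E) {d e k k' : V ≃ₗ[ZMod 2] V}

include hE

lemma finrank_sup (hd : d ∈ E) (he : e ∈ E) (hne : comm d ≠ comm e) :
    Module.finrank (ZMod 2) (comm d ⊔ comm e : Submodule (ZMod 2) V) = 4 := by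
  have := Module.finite_of_finrank_pos (by rw [hE.finrank _ hd]; simp : 0 <
    Module.finrank (ZMod 2) (comm d))
  have := Module.finite_of_finrank_pos (by rw [hE.finrank _ he]; simp : 0 <
    Module.finrank (ZMod 2) (comm e))
  have hinf : comm d ⊓ comm e = ⊥ := by
    rw [Submodule.eq_bot_iff]
    rintro x ⟨hx, hx'⟩
    by_contra h0
    exact hne (hE.line_eq hd he hx hx' h0)
  have h := Submodule.finrank_sup_add_finrank_inf_eq (comm d) (comm e)
  rw [hinf, finrank_bot, hE.finrank _ hd, hE.finrank _ he] at h
  omega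

/-- By `no_fixed_line` neither line is centralized by d. Unless k has the line of d, the same
4-space is [V,k] + [V,d], so the argument repeats with k in place of d. This turns collinearity in Δ
into not centralizing. -/
lemma not_fixes_of_le_sup (hd : d ∈ E) (he : e ∈ E) (hk : k ∈ E) (hk' : k' ∈ E)
    (hne : comm d ≠ comm e) (h : ¬ Fixes d e) (hle : comm k ≤ comm d ⊔ comm e)
    (hle' : comm k' ≤ comm d ⊔ comm e) : ¬ Fixes k k' := by
  have hdk := hE.no_fixed_line hd he hne h hk hle
  have hdk' := hE.no_fixed_line hd he hne h hk' hle'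
  by_cases heq : comm k = comm d
  · intro hfix
    refine hE.not_fixes_symm hd hk' hdk' fun x hx => ?_
    exact hE.fixes_symm hk hk' hfix x (heq ▸ hx)
  · refine hE.no_fixed_line hk hd heq (hE.not_fixes_symm hd hk hdk) hk' ?_
    have hfin : Module.Finite (ZMod 2) (comm d ⊔ comm e : Submodule (ZMod 2) V) :=
      Module.finite_of_finrank_pos (by rw [hE.finrank_sup hd he hne]; norm_num)
    have hW : comm k ⊔ comm d = comm d ⊔ comm e :=
      Submodule.eq_of_le_of_finrank_le (sup_le hle le_sup_left)
        (by rw [hE.finrank_sup hk hd heq, hE.finrank_sup hd he hne])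
    rwa [hW]

end IsRootSet

lemma isRootSet_symmetrize {G : Subgroup (V ≃ₗ[ZMod 2] V)} {D : Set (V ≃ₗ[ZMod 2] V)}
    (hgen : Subgroup.closure D = G) (hnormal : ∀ g ∈ G, ∀ d ∈ D, g * d * g⁻¹ ∈ D)
    (horder : ∀ d ∈ D, orderOf d = 3) (hdim : ∀ d ∈ D, Module.finrank (ZMod 2) (comm d) = 2)
    (hpoints : dPoints D = ∅) (hfull : fullSpreads D = ∅) : IsRootSet (symmetrize D) := by
  have hpow : ∀ d ∈ symmetrize D, d ^ 3 = 1 := by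
    rintro d (hd | hd)
    · rw [← horder d hd, pow_orderOf_eq_one]
    · have := pow_orderOf_eq_one d⁻¹
      rwa [horder _ hd, inv_pow, inv_eq_one] at this
  refine ⟨?_, ?_, fun d hd x => ?_, fun d hd => ?_, ?_, ?_⟩
  · intro g hg d hd
    have hgG : g ∈ G := by
      rw [← hgen, ← closure_symmetrize]
      exact Subgroup.subset_closure hg
    refine hd.imp (hnormal g hgG d) fun hd => ?_
    have := hnormal g hgG _ hd
    rwa [← conj_inv] at this
  · intro d hd
    refine hd.symm.imp id fun hd => ?_
    rwa [inv_inv]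
  · have h1 : (d ^ 3) x = d (d (d x)) := rfl
    rw [← h1, hpow d hd]
    rfl
  · obtain ⟨d', hd', h1, -⟩ := exists_mem_symmetrize D hd
    rw [← h1, hdim d' hd']
  · rw [dPoints, dLines_symmetrize]
    exact hpoints
  · rw [fullSpreads, dLines_symmetrize]
    exact hfull

lemma isConnectedRootSet_symmetrize {G : Subgroup (V ≃ₗ[ZMod 2] V)} {D : Set (V ≃ₗ[ZMod 2] V)}
    (hgen : Subgroup.closure D = G) (hVG : ⨆ g ∈ G, comm g = ⊤) (hCG : ⨅ g ∈ G, cent g = ⊥)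
    (hconn : (deltaGraph D).Connected) (hfull : fullSpreads D = ∅)
    (hE : IsRootSet (symmetrize D)) : IsConnectedRootSet (symmetrize D) := by
  refine { hE with span := ?_, cent := ?_, nonempty := ?_, conn := ?_ }
  · rw [eq_top_iff, ← hVG]
    refine iSup₂_le fun g hg => ?_
    rw [← hgen, ← closure_symmetrize] at hg
    have key : ∀ d ∈ symmetrize D, comm d ≤ ⨆ d ∈ symmetrize D, comm d := fun d hd =>
      le_iSup₂_of_le d hd le_rfl
    refine Subgroup.closure_induction
      (p := fun g _ => comm g ≤ ⨆ d ∈ symmetrize D, comm d) key ?_ ?_ ?_ hg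
    · intro x hx
      obtain ⟨y, rfl⟩ := mem_comm.1 hx
      change y + y ∈ _
      rw [two_add]
      exact Submodule.zero_mem _
    · intro a b _ _ ha hb x hx
      obtain ⟨y, rfl⟩ := mem_comm.1 hx
      have h1 : (a * b) y + y = (a (b y) + b y) + (b y + y) := by
        rw [LinearEquiv.mul_apply]
        linear_combination (norm := module) -two_add (b y)
      rw [h1]
      exact Submodule.add_mem _ (ha (add_mem_comm a (b y))) (hb (add_mem_comm b y))
    · intro a _ ha
      rwa [comm_inv]
  · intro x hx
    have h1 : x ∈ ⨅ g ∈ G, OrderThree.cent g := by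
      simp only [Submodule.mem_iInf]
      intro g hg
      rw [← hgen, ← closure_symmetrize] at hg
      refine Subgroup.closure_induction (p := fun g _ => x ∈ OrderThree.cent g)
        (fun d hd => mem_cent.2 (hx d hd)) (mem_cent.2 rfl) ?_ ?_ hg
      · intro a b _ _ ha hb
        rw [mem_cent] at *
        rw [LinearEquiv.mul_apply, hb, ha]
      · intro a _ ha
        rwa [cent_inv]
    rw [hCG] at h1
    exact h1
  · obtain ⟨⟨l, d, hd, -⟩⟩ := hconn.nonempty
    exact ⟨d, Or.inl hd⟩
  · intro d₀ hd₀ Q hQ hstep e he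
    have hline : ∀ d ∈ symmetrize D, comm d ∈ dLines D := fun d hd => by
      rw [← dLines_symmetrize]
      exact ⟨d, hd, rfl⟩
    have hreach := hconn.preconnected ⟨comm d₀, hline d₀ hd₀⟩ ⟨comm e, hline e he⟩
    rw [SimpleGraph.reachable_iff_reflTransGen] at hreach
    have key : ∀ l : dLines D, Relation.ReflTransGen (deltaGraph D).Adj ⟨comm d₀, hline d₀ hd₀⟩ l →
        ∀ e ∈ symmetrize D, comm e = l.1 → Q e := by
      intro l hl
      induction hl with
      | refl =>
        -- Different roots may share a line, for instance d₀ and its inverse; one step of the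
        -- relation joins them, since no root centralizes its own line.
        intro e he hel
        refine hstep d₀ hd₀ e he hQ fun hfix => hE.not_fixes_self hd₀ fun x hx => ?_
        exact hfix x (by rwa [hel])
      | @tail b c _ hbc ih =>
        intro e he hel
        obtain ⟨hne, S, hS, hbS, hcS⟩ := hbc
        rw [hfull, Set.empty_union] at hS
        obtain ⟨a₁, ha₁, a₂, ha₂, hne', hcent, -, hspread, -⟩ := hS
        have hfix : ¬ Fixes a₁ a₂ := fun h => hcent fun x hx => mem_cent.2 (h x hx)
        obtain ⟨k, hk, hkb⟩ := b.2
        refine hstep k (Or.inl hk) e he (ih k (Or.inl hk) hkb.symm) ?_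
        refine hE.not_fixes_of_le_sup (Or.inl ha₁) (Or.inl ha₂) (Or.inl hk) he hne' hfix ?_ ?_
        · rw [← hkb]
          exact (hspread.2.2.1 _ hbS).1
        · rw [hel]
          exact (hspread.2.2.1 _ hcS).1
    exact key _ hreach e he rfl

end Reduction
end OrderThree

theorem theorem4p18 {V : Type*} [AddCommGroup V] [Module (ZMod 2) V]
    (G : Subgroup (V ≃ₗ[ZMod 2] V)) (D : Set (V ≃ₗ[ZMod 2] V))
    (hgen : Subgroup.closure D = G)
    (hnormal : ∀ g ∈ G, ∀ d ∈ D, g * d * g⁻¹ ∈ D)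
    (horder : ∀ d ∈ D, orderOf d = 3)
    (hdim : ∀ d ∈ D, Module.finrank (ZMod 2) (OrderThree.comm d) = 2)
    (hVG : ⨆ g ∈ G, OrderThree.comm g = ⊤)
    (hCG : ⨅ g ∈ G, OrderThree.cent g = ⊥)
    (hpoints : OrderThree.dPoints D = ∅)
    (hconn : (OrderThree.deltaGraph D).Connected)
    (hfull : OrderThree.fullSpreads D = ∅) :
    OrderThree.IsProjectiveSpace (OrderThree.geomPoints D) (OrderThree.geomBlocks D) 4 ∧
    ∃ (_ : Module OrderThree.F4 V)
      (h : V →ₗ[OrderThree.F4] V →ₛₗ[frobenius OrderThree.F4 2] OrderThree.F4),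
      OrderThree.IsNondegHermitian h ∧
      OrderThree.IsProjectiveSpaceOf V (OrderThree.geomPoints D) (OrderThree.geomBlocks D) ∧
      (∃ π, OrderThree.IsHermitianPolarity h (OrderThree.geomPoints D)
          (OrderThree.geomBlocks D) π ∧
        OrderThree.absolutePoints (OrderThree.geomPoints D) π = OrderThree.singularLines D) ∧
      (∃ e : G ≃* OrderThree.finitaryUnitary h, ∀ (g : G) (x : V), (e g).1 x = g.1 x) ∧
      {g | g ∈ G ∧ OrderThree.IsReflection g} =
        ⋃ a ∈ {a : OrderThree.F4 | a ≠ 0 ∧ a ≠ 1}, OrderThree.unitaryReflections h a ∧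
      (∀ a : OrderThree.F4, a ≠ 0 → a ≠ 1 → ∃ r ∈ G,
        OrderThree.unitaryReflections h a = {s | ∃ g ∈ G, s = g * r * g⁻¹}) ∧
      ∃ A : Set OrderThree.F4, A.Nonempty ∧ A ⊆ {a | a ≠ 0 ∧ a ≠ 1} ∧
        D = ⋃ a ∈ A, OrderThree.unitaryReflections h a := by
  have hR := OrderThree.isConnectedRootSet_symmetrize hgen hVG hCG hconn hfull
    (OrderThree.isRootSet_symmetrize hgen hnormal horder hdim hpoints hfull)
  obtain ⟨inst, hlin, hscal⟩ := hR.exists_module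
  have hL : OrderThree.IsLinearRootSet (OrderThree.symmetrize D) :=
    { hR with linear := hlin, scalar := hscal }
  obtain ⟨h, hh, hroot⟩ := hL.exists_form
  have hE : OrderThree.IsUnitaryRootSet h (OrderThree.symmetrize D) :=
    { hL with nondeg := hh, root := hroot }
  have hG : Subgroup.closure (OrderThree.symmetrize D) = G := by
    rw [OrderThree.closure_symmetrize, hgen]
  -- The geometry of D is that of its symmetrization, which is the projective space of V₄.
  rw [← OrderThree.geomPoints_symmetrize, ← OrderThree.geomBlocks_symmetrize,
    ← OrderThree.singularLines_symmetrize, hE.geomPoints_eq, hE.geomBlocks_eq]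
  have hne : D.Nonempty := by
    obtain ⟨⟨l, d, hd, -⟩⟩ := hconn.nonempty
    exact ⟨d, hd⟩
  refine ⟨OrderThree.isProjectiveSpace_pts, inst, h, hh, OrderThree.isProjectiveSpaceOf_pts,
    ⟨_, OrderThree.isHermitianPolarity_perpPoints hh, hE.absolutePoints_eq⟩,
    hE.exists_mulEquiv hG, ?_, ?_, ?_⟩
  · rw [← hG]
    exact hE.setOf_isReflection
  · rw [← hG]
    exact fun a => hE.unitaryReflections_eq_conj
  · exact hE.eq_iUnion_unitaryReflections (OrderThree.subset_symmetrize D) hne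
      (by rw [hG]; exact hnormal)
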